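/- **Model.** $n$ processes share an array of at most $2n$ slots with values in $\{0,1\}$, split into $\lfloor\log_2 n\rfloor$ consecutive batches $B_0,B_1,\dots$ of sizes $|B_0|=\lfloor 3n/2\rfloor$ and $|B_i|=\lfloor n/2^{i+1}\rfloor$ for $i\ge 1$, and a backup array of $n$ slots. In a $\mathrm{Get}$, a process goes through the batches in increasing order and performs in $B_i$ up to $c_i$ test-and-set operations on independent uniformly random slots of $B_i$; it stops, and holds the slot, at the first test-and-set that it wins (i.e. that changes a slot from $0$ to $1$). If it loses all of them, it probes the slots of the backup array sequentially until it wins one. A $\mathrm{Free}$ resets the held slot to $0$ in one step, a $\mathrm{Collect}$ reads all locations one by one, and a $\mathrm{Call}$ is one step that does not access the array. Before the execution, and independently of the coin flips, an oblivious adversary fixes the input of each process (a sequence of these operations in which $\mathrm{Get}$ and $\mathrm{Free}$ alternate, starting with $\mathrm{Get}$, or with $\mathrm{Free}$ if the process initially holds a slot) and an infinite schedule $\sigma$, where $\sigma_t$ is the process that takes a step at time $t$. In an *arbitrary initial state*, processes may hold slots (no slot is held twice, and exactly the held slots have value $1$) and may be in the middle of an operation. The execution is *compact with exponent* $B\ge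 0$ if, for all outcomes of the coin flips, whenever a process initiates a $\mathrm{Get}$ at time $t$, it executes a $\mathrm{Free}$ at some time $t'$ with $t<t'<t+n^B$, and every process that initially holds a slot or is in the middle of a $\mathrm{Get}$ executes a $\mathrm{Free}$ at some time $t'<n^B$. **Theorem.** Let $\gamma\ge 1$ and $\rho\ge 1$. For all sufficiently large integers $\kappa$ (depending on $\gamma,\rho$) there is a constant $C$ such that for every $B\ge 0$ there is $n_0$ such that the following holds for all $n\ge n_0$, all numbers of trials $c_i$ with $\kappa\le c_i\le\rho\kappa$ (for instance $c_i=\kappa$ for all $i$), every initial state, and every choice of inputs and infinite schedule for which the execution is compact with exponent $B$. Let $\mathrm{op}$ be any fixed $\mathrm{Get}$ in the input of any process. 1. If the array is initially empty and no process has started, then with probability at least $1-1/n^{\gamma}$: if $\mathrm{op}$ is ever initiated, then it completes after at most $C\log_2\log_2 n$ steps of its process. 2. From an arbitrary initial state, with probability at least $1-1/n^{\gamma}$: if $\mathrm{op}$ is initiated at a time $t\ge n^{B}\log_2\log_2 n$, then it completes after at most $C\log_2\log_2 n$ steps of its process. -/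

import Mathlib

namespace LevelArray

open MeasureTheory

/-! ### Layout of the shared array -/

/-- Number of batches of the main array, `⌊log₂ n⌋`. -/
def numBatches (n : ℕ) : ℕ := Nat.log 2 n

/-- Number of slots of batch `b`: `⌊3n/2⌋` for `b = 0` and `⌊n/2^(b+1)⌋` for `b ≥ 1`. -/
def batchSize (n b : ℕ) : ℕ := if b = 0 then 3 * n / 2 else n / 2 ^ (b + 1)

/-- Index of the first slot of batch `b`. -/
def batchStart (n b : ℕ) : ℕ := ∑ k ∈ Finset.range b, batchSize n k

/-- Total number of slots of the main array (at most `2n`). -/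
def mainSize (n : ℕ) : ℕ := batchStart n (numBatches n)

theorem batchSize_pos (n b : ℕ) (hb : b < numBatches n) : 0 < batchSize n b := by
  have hn : n ≠ 0 := by
    rintro rfl
    simp [numBatches] at hb
  have h1 : 2 ^ (b + 1) ≤ n := Nat.pow_le_of_le_log hn hb
  have h2 : 2 ≤ 2 ^ (b + 1) := by
    rw [pow_succ]
    have := Nat.one_le_two_pow (n := b)
    omega
  unfold batchSize
  split_ifs
  · omega
  · exact Nat.div_pos h1 (by positivity)

/-! ### Random choices -/

/-- The randomness offered to one step: for every batch, a slot of that batch. A step that probes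
batch `b` uses the entry of `b` only. -/
abbrev Coin (n : ℕ) : Type := (b : Fin (numBatches n)) → Fin (batchSize n b)

instance coinNonempty (n : ℕ) : Nonempty (Coin n) :=
  ⟨fun b => ⟨0, batchSize_pos n b b.isLt⟩⟩

/-- The sample space: fresh randomness for every time step. -/
abbrev Coins (n : ℕ) : Type := ℕ → Coin n

/-- The law of the random choices: independent over the time steps, and uniform on
`Coin n` (so every probe of batch `b` is uniform over the slots of `b`) at each of them. -/
noncomputable def coinMeasure (n : ℕ) : Measure (Coins n) :=
  Measure.infinitePi (fun _ : ℕ => (PMF.uniformOfFintype (Coin n)).toMeasure)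

/-! ### Operations, adversary, configurations -/

/-- The operations that may occur in the input of a process. -/
inductive Op : Type where
  | get : Op
  | free : Op
  | collect : Op
  | call : Op
  deriving DecidableEq

/-- What the oblivious adversary fixes in advance for `n` processes: the input of each process
(its sequence of operations) and the infinite schedule (the process that steps at each time). -/
structure Adversary (n : ℕ) where
  input : Fin n → ℕ → Op
  schedule : ℕ → Fin n

/-- Local state of a process. `pc` is the position in its input of the current operation (that is,
the number of operations already completed). If the current operation is a `get`, then
`(batch, trial)` says that the next test-and-set is trial number `trial` in batch number `batch`;
`batch ≥ numBatches n` means that it is in the backup array. If the current operation is a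
`collect`, then `trial` is the number of locations already read. An operation that has not
taken a step yet is at `(0, 0)`. `held` is the index held by the process, if any. -/
structure ProcState : Type where
  pc : ℕ
  batch : ℕ
  trial : ℕ
  held : Option ℕ

/-- A configuration: the values of the shared locations (`true` for `1`) and the local states.
The slots of the main array have indices `0, …, mainSize n - 1`, those of the backup array have
indices `2n, …, 3n - 1`. -/
structure Config (n : ℕ) where
  mem : ℕ → Bool
  proc : Fin n → ProcState

/-- The configuration in which all locations are `0` and no process has started. -/
def emptyConfig (n : ℕ) : Config n where
  mem := fun _ => false
  proc := fun _ => { pc := 0, batch := 0, trial := 0, held := none }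

/-- The location accessed by a test-and-set of a `get` at `(batch, trial)`: a random slot of the
batch, or, in the backup array, the slots one after the other (cyclically). -/
def probeLoc (n : ℕ) (u : Coin n) (batch trial : ℕ) : ℕ :=
  if h : batch < numBatches n then batchStart n batch + (u ⟨batch, h⟩ : ℕ)
  else 2 * n + trial % n

/-- The local state at the beginning of the next operation. -/
def nextOp (l : ProcState) (held : Option ℕ) : ProcState :=
  { pc := l.pc + 1, batch := 0, trial := 0, held := held }

/-- The local state after a lost test-and-set; `c b` is the number of trials in batch `b`. -/
def afterLoss (n : ℕ) (c : ℕ → ℕ) (l : ProcState) : ProcState :=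
  if l.batch < numBatches n ∧ c l.batch ≤ l.trial + 1 then
    { l with batch := l.batch + 1, trial := 0 }
  else { l with trial := l.trial + 1 }

/-- One step (one shared-memory operation, or one `call`) of process `p`, using randomness `u`.
A `collect` reads all locations of the main and the backup array, one per step; the values read
influence no later step, so they are not recorded. -/
def step {n : ℕ} (c : ℕ → ℕ) (A : Adversary n) (p : Fin n) (u : Coin n) (s : Config n) :
    Config n :=
  let l := s.proc p
  match A.input p l.pc with
  | Op.get =>
      let x := probeLoc n u l.batch l.trial
      if s.mem x then { s with proc := Function.update s.proc p (afterLoss n c l) }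
      else
        { mem := Function.update s.mem x true
          proc := Function.update s.proc p (nextOp l (some x)) }
  | Op.free =>
      { mem := match l.held with
          | some x => Function.update s.mem x false
          | none => s.mem
        proc := Function.update s.proc p (nextOp l none) }
  | Op.collect =>
      if l.trial + 1 < mainSize n + n then
        { s with proc := Function.update s.proc p { l with trial := l.trial + 1 } }
      else { s with proc := Function.update s.proc p (nextOp l l.held) }
  | Op.call => { s with proc := Function.update s.proc p (nextOp l l.held) }

/-- The configuration just before the step at time `t`. -/
def run {n : ℕ} (c : ℕ → ℕ) (A : Adversary n) (s₀ : Config n) (ω : Coins n) : ℕ → Config n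
  | 0 => s₀
  | t + 1 => step c A (A.schedule t) (ω t) (run c A s₀ ω t)

/-! ### Well-formed inputs and initial states -/

/-- `Get` and `Free` alternate in the input, starting with `Get` if the process holds
nothing (`h = 0`), and with `Free` if it initially holds an index (`h = 1`). -/
def Alternating (h : ℕ) (input : ℕ → Op) : Prop :=
  ∀ i : ℕ,
    Nat.count (fun j => input j = Op.free) i ≤ h + Nat.count (fun j => input j = Op.get) i ∧
    h + Nat.count (fun j => input j = Op.get) i ≤ Nat.count (fun j => input j = Op.free) i + 1

/-- `s₀` is a possible state of the array and of the processes at time `0`: processes may hold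
indices, and be in the middle of a `get` or a `collect` (which is then the first operation
of their input); no index is held twice, and exactly the locations that are held are set. The
inputs are well formed. -/
structure IsInitial {n : ℕ} (A : Adversary n) (s₀ : Config n) : Prop where
  pc_eq : ∀ p, (s₀.proc p).pc = 0
  inProgress : ∀ p, ((s₀.proc p).batch ≠ 0 ∨ (s₀.proc p).trial ≠ 0) →
    A.input p 0 = Op.get ∨ (A.input p 0 = Op.collect ∧ (s₀.proc p).batch = 0)
  alternating : ∀ p, Alternating (if (s₀.proc p).held.isSome then 1 else 0) (A.input p)
  held_lt : ∀ p x, (s₀.proc p).held = some x → x < mainSize n ∨ (2 * n ≤ x ∧ x < 3 * n)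
  held_inj : ∀ p p' x, (s₀.proc p).held = some x → (s₀.proc p').held = some x → p = p'
  mem_iff : ∀ x, s₀.mem x = true ↔ ∃ p, (s₀.proc p).held = some x

/-! ### Events of an execution -/

/-- At time `t`, process `p` takes the first step of the operation at position `i` of its input. -/
def Initiates {n : ℕ} (c : ℕ → ℕ) (A : Adversary n) (s₀ : Config n) (ω : Coins n)
    (p : Fin n) (i t : ℕ) : Prop :=
  A.schedule t = p ∧ ((run c A s₀ ω t).proc p).pc = i ∧
    ((run c A s₀ ω t).proc p).batch = 0 ∧ ((run c A s₀ ω t).proc p).trial = 0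

/-- At time `t`, process `p` executes a `free`. -/
def ExecutesFree {n : ℕ} (c : ℕ → ℕ) (A : Adversary n) (s₀ : Config n) (ω : Coins n)
    (p : Fin n) (t : ℕ) : Prop :=
  A.schedule t = p ∧ A.input p ((run c A s₀ ω t).proc p).pc = Op.free

/-- In `s₀`, process `p` holds an index or has begun, but not completed, a `get`. -/
def Engaged {n : ℕ} (A : Adversary n) (s₀ : Config n) (p : Fin n) : Prop :=
  (s₀.proc p).held.isSome ∨
    (A.input p (s₀.proc p).pc = Op.get ∧ ((s₀.proc p).batch ≠ 0 ∨ (s₀.proc p).trial ≠ 0))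

/-- The execution is compact with exponent `B`: whatever the coin flips, a process that
initiates a `get` at time `t` executes a `free` before time `t + n ^ B`. A `get` that was initiated
before time `0`, and whose index is not freed yet, counts as initiated at time `0`. -/
def CompactSchedule {n : ℕ} (c : ℕ → ℕ) (A : Adversary n) (s₀ : Config n) (B : ℝ) : Prop :=
  (∀ (ω : Coins n) (p : Fin n) (i t : ℕ), A.input p i = Op.get → Initiates c A s₀ ω p i t →
    ∃ t' : ℕ, t < t' ∧ (t' : ℝ) < (t : ℝ) + (n : ℝ) ^ B ∧ ExecutesFree c A s₀ ω p t') ∧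
  (∀ (ω : Coins n) (p : Fin n), Engaged A s₀ p →
    ∃ t' : ℕ, (t' : ℝ) < (n : ℝ) ^ B ∧ ExecutesFree c A s₀ ω p t')

open Classical in
/-- Number of steps that process `p` takes, before time `T`, in the operation at position `i`
of its input. -/
noncomputable def opSteps {n : ℕ} (c : ℕ → ℕ) (A : Adversary n) (s₀ : Config n) (ω : Coins n)
    (p : Fin n) (i T : ℕ) : ℕ :=
  ((Finset.range T).filter
    (fun t => A.schedule t = p ∧ ((run c A s₀ ω t).proc p).pc = i)).card

/-- The operation at position `i` of the input of `p` completes, after at most `m` steps of `p`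
in it. -/
def CompletesWithin {n : ℕ} (c : ℕ → ℕ) (A : Adversary n) (s₀ : Config n) (ω : Coins n)
    (p : Fin n) (i : ℕ) (m : ℝ) : Prop :=
  ∃ T : ℕ, i < ((run c A s₀ ω T).proc p).pc ∧ (opSteps c A s₀ ω p i T : ℝ) ≤ m

/-- `log log n`, to base `2`. -/
noncomputable def loglog (n : ℕ) : ℝ := Real.logb 2 (Real.logb 2 (n : ℝ))

end LevelArray

/-! Call a batch `a` good if its load is at most m_a, where m_0 = n and m_a = n/2^(4^a)
(`threshold`), for a up to J = `lastLevel n`, about half of log log n. A probe of a good batch is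
lost with probability at most f_a (`lossBound`): 3/4 for a = 0, and 2^-(4^a-(a+1)) afterwards. If
batch J is good whenever a fixed Get takes a step, that Get leaves batch J with probability at most
f_J^(c_J) ≤ n^-(γ+1) (`measure_pass_le`, `lossBound_lastLevel_pow_le`); otherwise it ends within the
O(log log n) trials of the batches up to J. It remains to show that batch J is good.

Batch 0 always is, since at most n slots are held. Suppose batch a is good during a window of length
N = ⌈n^B⌉ that ends at T. By compactness, every process that is busy when the window opens executes
a Free before T, so a slot of batch a+1 held at T was won by a Get begun inside the window, which
lost c_a trials in batch a. The coins shift all later operations of a process, so it is random which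
of its Gets is decisive at T. But the schedule fixes how many steps remain before T, and a Get that
would be followed by a Free before T wherever it wins up to batch a+1 cannot be decisive. Hence at
most K = c_0 + ... + c_(a+1) Gets of a process matter, and it holds a slot of batch a+1 at T with
probability at most K f_a^(c_a). `potential` expresses this as a supermartingale
(`lintegral_potential_step`).

Only one process moves at a time, so the product of 1 + potential over all processes is again a
supermartingale, with no independence between processes needed. At time T it dominates 2^load, which
yields the tail bound `measure_load_mul_pow_le`; with the chosen thresholds, batch a+1 is bad with
probability at most exp(-√n/4) (`thresholds_lastLevel`). Induction over the levels reaches back D =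
J·N time units (`measure_overload_le`).

The execution is infinite and the time of the Get is random, so a union bound over all times is not
available. The tail bound is therefore proved relative to any event decided D time units earlier.
Times at which the process steps while its counter, D units before, was within D of the given
position are only polynomially many for every outcome, so the probabilities of these events have a
polynomial sum (`measure_exists_overload_le`). -/

namespace LevelArray

open MeasureTheory
open scoped ENNReal

/-! ### Resampling one coordinate of a product measure -/

section Resampling

variable {X : ℕ → Type*} [∀ i, MeasurableSpace (X i)]

theorem measurable_update_prod (t : ℕ) :
    Measurable (fun z : (∀ i, X i) × X t => Function.update z.1 t z.2) := by
  rw [measurable_pi_iff]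
  intro i
  by_cases h : i = t
  · subst h
    simpa using measurable_snd
  · simp only [Function.update_of_ne h]
    exact (measurable_pi_apply i).comp measurable_fst

variable (μ : (i : ℕ) → Measure (X i)) [∀ i, IsProbabilityMeasure (μ i)]

/-- A fresh independent sample in coordinate `t` does not change the product law; it suffices to
compare the two measures on finite boxes. -/
theorem map_update_infinitePi (t : ℕ) :
    ((Measure.infinitePi μ).prod (μ t)).map (fun z => Function.update z.1 t z.2) =
      Measure.infinitePi μ := by
  have hmeas := measurable_update_prod (X := X) t
  refine Measure.eq_infinitePi _ fun s S hS => ?_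
  rw [Measure.map_apply hmeas (MeasurableSet.pi s.countable_toSet fun i _ => hS i)]
  by_cases ht : t ∈ s
  · have : (fun z : (∀ i, X i) × X t => Function.update z.1 t z.2) ⁻¹' (Set.pi s S) =
        (Set.pi (s.erase t) S) ×ˢ (S t) := by
      ext z
      simp only [Set.mem_preimage, Set.mem_pi, Finset.mem_coe, Set.mem_prod, Finset.mem_erase]
      constructor
      · intro h
        refine ⟨fun i hi => ?_, ?_⟩
        · have := h i hi.2
          rwa [Function.update_of_ne hi.1] at this
        · simpa using h t ht
      · rintro ⟨h1, h2⟩ i hi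
        by_cases h : i = t
        · subst h
          simpa using h2
        · rw [Function.update_of_ne h]
          exact h1 i ⟨h, hi⟩
    rw [this, Measure.prod_prod, Measure.infinitePi_pi μ (fun i _ => hS i), mul_comm,
      Finset.mul_prod_erase s (fun i => μ i (S i)) ht]
  · have : (fun z : (∀ i, X i) × X t => Function.update z.1 t z.2) ⁻¹' (Set.pi s S) =
        (Set.pi s S) ×ˢ Set.univ := by
      ext z
      simp only [Set.mem_preimage, Set.mem_pi, Finset.mem_coe, Set.mem_prod, Set.mem_univ, and_true]
      refine forall₂_congr fun i hi => ?_
      rw [Function.update_of_ne (by rintro rfl; exact ht hi)]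
    rw [this, Measure.prod_prod, Measure.infinitePi_pi μ (fun i _ => hS i), measure_univ, mul_one]

/-- This replaces conditional expectations: averaging over coordinate `t` alone, with all others
frozen, is one step of the martingale arguments. -/
theorem lintegral_infinitePi_update (t : ℕ) {F : (∀ i, X i) → ℝ≥0∞} (hF : Measurable F) :
    ∫⁻ ω, F ω ∂(Measure.infinitePi μ) =
      ∫⁻ ω, ∫⁻ u, F (Function.update ω t u) ∂(μ t) ∂(Measure.infinitePi μ) := by
  have hmeas := measurable_update_prod (X := X) t
  conv_lhs => rw [← map_update_infinitePi μ t]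
  rw [lintegral_map hF hmeas]
  exact lintegral_prod _ (hF.comp hmeas).aemeasurable

end Resampling

/-! ### Functions of the past -/

/-- `F` is determined by the coins used before time `t`. -/
def Past {n : ℕ} {β : Type*} (t : ℕ) (F : Coins n → β) : Prop :=
  ∀ ω ω' : Coins n, (∀ r < t, ω r = ω' r) → F ω = F ω'

theorem Past.mono {n : ℕ} {β : Type*} {s t : ℕ} {F : Coins n → β} (hF : Past s F) (h : s ≤ t) :
    Past t F :=
  fun ω ω' hω => hF ω ω' fun r hr => hω r (hr.trans_le h)

theorem Past.comp {n : ℕ} {β γ : Type*} {t : ℕ} {F : Coins n → β} (hF : Past t F) (g : β → γ) :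
    Past t (fun ω => g (F ω)) :=
  fun ω ω' hω => congrArg g (hF ω ω' hω)

/-- A function of the past factors through finitely many coordinates with values in finite types, so
measurability costs nothing. -/
theorem Past.measurable {n : ℕ} {β : Type*} [MeasurableSpace β] {t : ℕ} {F : Coins n → β}
    (hF : Past t F) : Measurable F := by
  classical
  let e : (Finset.range t → Coin n) → Coins n :=
    fun x r => if h : r ∈ Finset.range t then x ⟨r, h⟩ else Classical.arbitrary _
  have h1 : F = (fun x => F (e x)) ∘ (fun ω : Coins n => fun r : Finset.range t => ω r) := by
    funext ω
    refine hF _ _ fun r hr => ?_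
    simp [e, hr]
  rw [h1]
  refine Measurable.comp (measurable_of_countable _) ?_
  exact measurable_pi_lambda _ fun r => measurable_pi_apply _

theorem Past.update {n : ℕ} {β : Type*} {t s : ℕ} {F : Coins n → β} (hF : Past t F) (h : t ≤ s)
    (ω : Coins n) (u : Coin n) : F (Function.update ω s u) = F ω :=
  hF _ _ fun r hr => Function.update_of_ne (by omega) _ _

/-- The law of the randomness of one step. -/
noncomputable def coinLaw (n : ℕ) : Measure (Coin n) := (PMF.uniformOfFintype (Coin n)).toMeasure

instance (n : ℕ) : IsProbabilityMeasure (coinLaw n) := by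
  unfold coinLaw; infer_instance

instance (n : ℕ) : IsProbabilityMeasure (coinMeasure n) := by
  unfold coinMeasure; infer_instance

/-- A nonnegative process that does not increase on average has nonincreasing expectations. -/
theorem lintegral_le_of_supermartingale {n : ℕ} {Φ : ℕ → Coins n → ℝ≥0∞} {τ T : ℕ} (hτ : τ ≤ T)
    (hΦ : ∀ t, τ ≤ t → Past t (Φ t))
    (hstep : ∀ t, τ ≤ t → t < T → ∀ ω : Coins n,
      ∫⁻ u, Φ (t + 1) (Function.update ω t u) ∂(coinLaw n) ≤ Φ t ω) :
    ∫⁻ ω, Φ T ω ∂(coinMeasure n) ≤ ∫⁻ ω, Φ τ ω ∂(coinMeasure n) := by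
  induction T, hτ using Nat.le_induction with
  | base => exact le_rfl
  | succ T hT ih =>
    refine le_trans ?_ (ih fun t h1 h2 => hstep t h1 (by omega))
    have := lintegral_infinitePi_update
      (fun _ : ℕ => (PMF.uniformOfFintype (Coin n)).toMeasure) T
      (hΦ (T + 1) (by omega)).measurable
    unfold coinMeasure
    rw [this]
    exact lintegral_mono fun ω => hstep T hT (by omega) ω

/-- The probability that the slot of batch `b` offered by a coin satisfies `P`. -/
theorem coinLaw_apply {n : ℕ} (b : Fin (numBatches n)) (P : ℕ → Prop) [DecidablePred P] :
    coinLaw n {u | P (u b)} =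
      ((Finset.range (batchSize n b)).filter P).card / (batchSize n b : ℝ≥0∞) := by
  classical
  -- All fibres of the evaluation at `b` have the same size, so a uniform coin has a uniform entry
  -- in each batch.
  have key : ∀ j : Fin (batchSize n b), (Finset.univ.filter fun u : Coin n => u b = j).card *
      batchSize n b = Fintype.card (Coin n) := by
    intro j
    have := Fintype.card_filter_piFinset_eq_of_mem
      (fun i : Fin (numBatches n) => (Finset.univ : Finset (Fin (batchSize n i)))) b
      (Finset.mem_univ j)
    rw [Fintype.piFinset_univ] at this
    rw [this, Fintype.card_pi]
    simp only [Finset.card_univ, Fintype.card_fin]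
    exact Finset.prod_erase_mul _ _ (Finset.mem_univ b)
  have hcard : (Finset.univ.filter fun u : Coin n => P (u b)).card * batchSize n b =
      ((Finset.range (batchSize n b)).filter P).card * Fintype.card (Coin n) := by
    have h1 : (Finset.univ.filter fun u : Coin n => P (u b)).card =
        ∑ j ∈ (Finset.univ.filter fun j : Fin (batchSize n b) => P j),
          (Finset.univ.filter fun u : Coin n => u b = j).card := by
      rw [Finset.card_eq_sum_card_fiberwise (f := fun u : Coin n => u b)
        (t := Finset.univ.filter fun j : Fin (batchSize n b) => P j)]
      · refine Finset.sum_congr rfl fun j hj => ?_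
        congr 1
        ext u
        simp only [Finset.mem_filter, Finset.mem_univ, true_and] at hj ⊢
        constructor
        · exact fun h => h.2
        · exact fun h => ⟨h ▸ hj, h⟩
      · intro u hu
        simpa using hu
    rw [h1, Finset.sum_mul, Finset.sum_congr rfl fun j _ => key j, Finset.sum_const, smul_eq_mul]
    congr 1
    refine Finset.card_bij (fun j _ => (j : ℕ)) (fun j hj => ?_)
      (fun i _ j _ h => Fin.ext h) (fun x hx => ?_)
    · simpa using hj
    · simp only [Finset.mem_filter, Finset.mem_range] at hx
      exact ⟨⟨x, hx.1⟩, by simpa using hx.2, rfl⟩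
  have hmeas : MeasurableSet {u : Coin n | P (u b)} := Set.Finite.measurableSet (Set.toFinite _)
  unfold coinLaw
  rw [PMF.toMeasure_uniformOfFintype_apply _ hmeas]
  have h0 : (batchSize n b : ℝ≥0∞) ≠ 0 := by
    exact_mod_cast (batchSize_pos n b b.isLt).ne'
  have h1 : (Fintype.card (Coin n) : ℝ≥0∞) ≠ 0 := by
    exact_mod_cast Fintype.card_ne_zero
  have h2 : Fintype.card {u : Coin n | P (u b)} =
      (Finset.univ.filter fun u : Coin n => P (u b)).card := by
    rw [← Fintype.card_subtype]; rfl
  rw [h2, ENNReal.div_eq_div_iff h0 (ENNReal.natCast_ne_top _) h1 (ENNReal.natCast_ne_top _)]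
  rw [mul_comm, mul_comm (Fintype.card (Coin n) : ℝ≥0∞)]
  exact_mod_cast hcard

/-! ### Single steps -/

section Step

variable {n : ℕ} {c : ℕ → ℕ} {A : Adversary n} {p q : Fin n} {u : Coin n} {s : Config n}

/-- The current operation of a process has taken a step. -/
def ProcState.Mid (l : ProcState) : Prop := l.batch ≠ 0 ∨ l.trial ≠ 0

theorem step_proc_of_ne (h : q ≠ p) : (step c A p u s).proc q = s.proc q := by
  unfold step
  dsimp only
  split
  · split_ifs <;> simp [h]
  · simp [h]
  · split_ifs <;> simp [h]
  · simp [h]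

theorem step_of_get_lost (hi : A.input p (s.proc p).pc = Op.get)
    (hm : s.mem (probeLoc n u (s.proc p).batch (s.proc p).trial) = true) :
    step c A p u s = { s with proc := Function.update s.proc p (afterLoss n c (s.proc p)) } := by
  simp [step, hi, hm]

theorem step_of_get_won (hi : A.input p (s.proc p).pc = Op.get)
    (hm : s.mem (probeLoc n u (s.proc p).batch (s.proc p).trial) = false) :
    step c A p u s =
      { mem := Function.update s.mem (probeLoc n u (s.proc p).batch (s.proc p).trial) true
        proc := Function.update s.proc p
          (nextOp (s.proc p) (some (probeLoc n u (s.proc p).batch (s.proc p).trial))) } := by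
  simp [step, hi, hm]

theorem step_of_free (hi : A.input p (s.proc p).pc = Op.free) :
    step c A p u s =
      { mem := match (s.proc p).held with
          | some x => Function.update s.mem x false
          | none => s.mem
        proc := Function.update s.proc p (nextOp (s.proc p) none) } := by
  simp only [step, hi]

theorem step_of_collect (hi : A.input p (s.proc p).pc = Op.collect)
    (h : (s.proc p).trial + 1 < mainSize n + n) :
    step c A p u s = { s with
      proc := Function.update s.proc p { s.proc p with trial := (s.proc p).trial + 1 } } := by
  simp [step, hi, h]

theorem step_of_collect_last (hi : A.input p (s.proc p).pc = Op.collect)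
    (h : ¬ (s.proc p).trial + 1 < mainSize n + n) :
    step c A p u s =
      { s with proc := Function.update s.proc p (nextOp (s.proc p) (s.proc p).held) } := by
  simp [step, hi, h]

theorem step_of_call (hi : A.input p (s.proc p).pc = Op.call) :
    step c A p u s =
      { s with proc := Function.update s.proc p (nextOp (s.proc p) (s.proc p).held) } := by
  simp [step, hi]

theorem afterLoss_pc (l : ProcState) : (afterLoss n c l).pc = l.pc := by
  unfold afterLoss; split_ifs <;> rfl

theorem afterLoss_held (l : ProcState) : (afterLoss n c l).held = l.held := by
  unfold afterLoss; split_ifs <;> rfl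

theorem afterLoss_mid (l : ProcState) : (afterLoss n c l).Mid := by
  unfold afterLoss ProcState.Mid; split_ifs <;> simp

/-- The effect of a step on the configuration, by cases. -/
theorem step_cases (c : ℕ → ℕ) (A : Adversary n) (p : Fin n) (u : Coin n) (s : Config n) :
    (A.input p (s.proc p).pc = Op.get ∧
      s.mem (probeLoc n u (s.proc p).batch (s.proc p).trial) = true ∧
      (step c A p u s).mem = s.mem ∧ (step c A p u s).proc p = afterLoss n c (s.proc p)) ∨
    (A.input p (s.proc p).pc = Op.get ∧
      s.mem (probeLoc n u (s.proc p).batch (s.proc p).trial) = false ∧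
      (step c A p u s).mem =
        Function.update s.mem (probeLoc n u (s.proc p).batch (s.proc p).trial) true ∧
      (step c A p u s).proc p =
        nextOp (s.proc p) (some (probeLoc n u (s.proc p).batch (s.proc p).trial))) ∨
    (A.input p (s.proc p).pc = Op.free ∧
      (step c A p u s).mem = (match (s.proc p).held with
          | some x => Function.update s.mem x false
          | none => s.mem) ∧
      (step c A p u s).proc p = nextOp (s.proc p) none) ∨
    (A.input p (s.proc p).pc = Op.collect ∧ (s.proc p).trial + 1 < mainSize n + n ∧
      (step c A p u s).mem = s.mem ∧
      (step c A p u s).proc p = { s.proc p with trial := (s.proc p).trial + 1 }) ∨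
    (((A.input p (s.proc p).pc = Op.collect ∧ ¬ (s.proc p).trial + 1 < mainSize n + n) ∨
        A.input p (s.proc p).pc = Op.call) ∧
      (step c A p u s).mem = s.mem ∧
      (step c A p u s).proc p = nextOp (s.proc p) (s.proc p).held) := by
  cases hi : A.input p (s.proc p).pc with
  | get =>
    cases hm : s.mem (probeLoc n u (s.proc p).batch (s.proc p).trial) with
    | true => left; rw [step_of_get_lost hi hm]; simp
    | false => right; left; rw [step_of_get_won hi hm]; simp
  | free => right; right; left; rw [step_of_free hi]; simp
  | collect =>
    by_cases h : (s.proc p).trial + 1 < mainSize n + n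
    · right; right; right; left; rw [step_of_collect hi h]; simp [h]
    · right; right; right; right; rw [step_of_collect_last hi h]; simp [h]
  | call => right; right; right; right; rw [step_of_call hi]; simp

/-- The counter of a process advances by at most one in a step. -/
theorem pc_step (q : Fin n) :
    (s.proc q).pc ≤ ((step c A p u s).proc q).pc ∧
      ((step c A p u s).proc q).pc ≤ (s.proc q).pc + 1 := by
  by_cases h : q = p
  · subst h
    rcases step_cases c A q u s with ⟨-, -, -, h⟩ | ⟨-, -, -, h⟩ | ⟨-, -, h⟩ | ⟨-, -, -, h⟩ |
      ⟨-, -, h⟩ <;> rw [h] <;> simp [afterLoss_pc, nextOp]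
  · rw [step_proc_of_ne h]; omega

/-- When the counter of a process advances, the new operation has not taken a step. -/
theorem not_mid_step (h : (s.proc q).pc < ((step c A p u s).proc q).pc) :
    ¬ ((step c A p u s).proc q).Mid := by
  by_cases hq : q = p
  · subst hq
    rcases step_cases c A q u s with ⟨-, -, -, h'⟩ | ⟨-, -, -, h'⟩ | ⟨-, -, h'⟩ | ⟨-, -, -, h'⟩ |
      ⟨-, -, h'⟩ <;> rw [h'] at h ⊢ <;> simp_all [afterLoss_pc, nextOp, ProcState.Mid]
  · rw [step_proc_of_ne hq] at h; omega

/-- An operation that has taken a step and is not completed remains so. -/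
theorem mid_step (hm : (s.proc q).Mid) (h : ((step c A p u s).proc q).pc = (s.proc q).pc) :
    ((step c A p u s).proc q).Mid := by
  by_cases hq : q = p
  · subst hq
    rcases step_cases c A q u s with ⟨-, -, -, h'⟩ | ⟨-, -, -, h'⟩ | ⟨-, -, h'⟩ | ⟨-, -, -, h'⟩ |
      ⟨-, -, h'⟩ <;> rw [h'] at h ⊢
    · exact afterLoss_mid _
    all_goals simp_all [nextOp, ProcState.Mid]
  · rwa [step_proc_of_ne hq]

/-- The relations between locations, held indices and inputs that hold throughout an execution;
`h q` tells whether `q` holds an index initially. -/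
structure Consistent (A : Adversary n) (h : Fin n → ℕ) (s : Config n) : Prop where
  alternating : ∀ q, Alternating (h q) (A.input q)
  held_inj : ∀ q q' x, (s.proc q).held = some x → (s.proc q').held = some x → q = q'
  mem_iff : ∀ x, s.mem x = true ↔ ∃ q, (s.proc q).held = some x
  count_eq : ∀ q, (if (s.proc q).held.isSome then 1 else 0) +
    Nat.count (fun j => A.input q j = Op.free) (s.proc q).pc =
      h q + Nat.count (fun j => A.input q j = Op.get) (s.proc q).pc

/-- Alternation is applied one position further on: counting the current `get` would otherwise put
the gets two ahead of the frees. -/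
theorem Consistent.held_of_get {h : Fin n → ℕ} (hs : Consistent A h s)
    (hi : A.input q (s.proc q).pc = Op.get) : (s.proc q).held = none := by
  have h1 := (hs.alternating q ((s.proc q).pc + 1)).2
  have h2 := hs.count_eq q
  rw [Nat.count_succ, Nat.count_succ] at h1
  simp only [hi, if_true, reduceCtorEq, if_false] at h1
  by_contra hne
  rw [← ne_eq, Option.ne_none_iff_isSome] at hne
  simp only [hne, if_true] at h2
  omega

theorem Consistent.held_of_free {h : Fin n → ℕ} (hs : Consistent A h s)
    (hi : A.input q (s.proc q).pc = Op.free) : ∃ x, (s.proc q).held = some x := by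
  have h1 := (hs.alternating q ((s.proc q).pc + 1)).1
  have h2 := hs.count_eq q
  rw [Nat.count_succ, Nat.count_succ] at h1
  simp only [hi, if_true, reduceCtorEq, if_false] at h1
  rw [← Option.isSome_iff_exists]
  by_contra hne
  simp only [hne] at h2
  simp at h2
  omega

theorem Consistent.step {h : Fin n → ℕ} (hs : Consistent A h s) :
    Consistent A h (step c A p u s) := by
  have hne : ∀ q, q ≠ p → (LevelArray.step c A p u s).proc q = s.proc q :=
    fun q hq => step_proc_of_ne hq
  rcases step_cases c A p u s with ⟨hi, hm, h1, h2⟩ | ⟨hi, hm, h1, h2⟩ | ⟨hi, h1, h2⟩ |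
      ⟨hi, -, h1, h2⟩ | ⟨hi, h1, h2⟩
  · have hheld : ∀ q, ((LevelArray.step c A p u s).proc q).held = (s.proc q).held := by
      intro q
      by_cases hq : q = p
      · subst hq; rw [h2, afterLoss_held]
      · rw [hne q hq]
    have hpc : ∀ q, ((LevelArray.step c A p u s).proc q).pc = (s.proc q).pc := by
      intro q
      by_cases hq : q = p
      · subst hq; rw [h2, afterLoss_pc]
      · rw [hne q hq]
    refine ⟨hs.alternating, ?_, ?_, ?_⟩
    · simpa only [hheld] using hs.held_inj
    · simpa only [hheld, h1] using hs.mem_iff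
    · simpa only [hheld, hpc] using hs.count_eq
  · have hnone := hs.held_of_get hi
    set x := probeLoc n u (s.proc p).batch (s.proc p).trial with hx
    have hfree : ∀ q, (s.proc q).held ≠ some x := by
      intro q hq
      have := (hs.mem_iff x).2 ⟨q, hq⟩
      simp [hm] at this
    refine ⟨hs.alternating, ?_, ?_, ?_⟩
    · intro q q' y hq hq'
      by_cases e : q = p <;> by_cases e' : q' = p
      · rw [e, e']
      · subst e
        rw [h2] at hq
        rw [hne q' e'] at hq'
        simp only [nextOp, Option.some.injEq] at hq
        exact absurd (hq ▸ hq') (hfree q')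
      · subst e'
        rw [h2] at hq'
        rw [hne q e] at hq
        simp only [nextOp, Option.some.injEq] at hq'
        exact absurd (hq' ▸ hq) (hfree q)
      · rw [hne q e] at hq
        rw [hne q' e'] at hq'
        exact hs.held_inj q q' y hq hq'
    · intro y
      rw [h1]
      by_cases hy : y = x
      · subst hy
        simp only [Function.update_self, true_iff]
        exact ⟨p, by rw [h2]; rfl⟩
      · rw [Function.update_of_ne hy, hs.mem_iff]
        constructor
        · rintro ⟨q, hq⟩
          refine ⟨q, ?_⟩
          have : q ≠ p := by rintro rfl; simp [hnone] at hq
          rwa [hne q this]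
        · rintro ⟨q, hq⟩
          by_cases e : q = p
          · subst e
            rw [h2] at hq
            simp only [nextOp, Option.some.injEq] at hq
            exact absurd hq.symm hy
          · exact ⟨q, by rwa [hne q e] at hq⟩
    · intro q
      by_cases e : q = p
      · subst e
        have := hs.count_eq q
        rw [h2]
        simp only [nextOp, Option.isSome_some, if_true, Nat.count_succ, hi, reduceCtorEq, if_false]
        simp [hnone] at this
        omega
      · rw [hne q e]; exact hs.count_eq q
  · obtain ⟨x, hx⟩ := hs.held_of_free hi
    simp only [hx] at h1
    refine ⟨hs.alternating, ?_, ?_, ?_⟩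
    · intro q q' y hq hq'
      have e : q ≠ p := by rintro rfl; rw [h2] at hq; simp [nextOp] at hq
      have e' : q' ≠ p := by rintro rfl; rw [h2] at hq'; simp [nextOp] at hq'
      rw [hne q e] at hq
      rw [hne q' e'] at hq'
      exact hs.held_inj q q' y hq hq'
    · intro y
      rw [h1]
      by_cases hy : y = x
      · subst hy
        simp only [Function.update_self, Bool.false_eq_true, false_iff, not_exists]
        intro q hq
        have e : q ≠ p := by rintro rfl; rw [h2] at hq; simp [nextOp] at hq
        rw [hne q e] at hq
        exact e (hs.held_inj q p y hq hx)
      · rw [Function.update_of_ne hy, hs.mem_iff]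
        constructor
        · rintro ⟨q, hq⟩
          have e : q ≠ p := by
            rintro rfl
            rw [hx, Option.some.injEq] at hq
            exact hy hq.symm
          exact ⟨q, by rwa [hne q e]⟩
        · rintro ⟨q, hq⟩
          have e : q ≠ p := by rintro rfl; rw [h2] at hq; simp [nextOp] at hq
          exact ⟨q, by rwa [hne q e] at hq⟩
    · intro q
      by_cases e : q = p
      · subst e
        have := hs.count_eq q
        rw [h2]
        simp only [nextOp, Nat.count_succ, hi, reduceCtorEq, if_false]
        simp [hx] at this
        simp
        omega
      · rw [hne q e]; exact hs.count_eq q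
  · have hheld : ∀ q, ((LevelArray.step c A p u s).proc q).held = (s.proc q).held := by
      intro q
      by_cases hq : q = p
      · subst hq; rw [h2]
      · rw [hne q hq]
    have hpc : ∀ q, ((LevelArray.step c A p u s).proc q).pc = (s.proc q).pc := by
      intro q
      by_cases hq : q = p
      · subst hq; rw [h2]
      · rw [hne q hq]
    refine ⟨hs.alternating, ?_, ?_, ?_⟩
    · simpa only [hheld] using hs.held_inj
    · simpa only [hheld, h1] using hs.mem_iff
    · simpa only [hheld, hpc] using hs.count_eq
  · have hheld : ∀ q, ((LevelArray.step c A p u s).proc q).held = (s.proc q).held := by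
      intro q
      by_cases hq : q = p
      · subst hq; rw [h2]; rfl
      · rw [hne q hq]
    refine ⟨hs.alternating, ?_, ?_, ?_⟩
    · simpa only [hheld] using hs.held_inj
    · simpa only [hheld, h1] using hs.mem_iff
    · intro q
      rw [hheld]
      by_cases e : q = p
      · subst e
        have := hs.count_eq q
        rw [h2]
        have h3 : A.input q (s.proc q).pc ≠ Op.get := by
          rcases hi with ⟨hi, -⟩ | hi <;> rw [hi] <;> decide
        have h4 : A.input q (s.proc q).pc ≠ Op.free := by
          rcases hi with ⟨hi, -⟩ | hi <;> rw [hi] <;> decide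
        simp only [nextOp, Nat.count_succ, h3, h4, if_false]
        exact this
      · rw [hne q e]; exact hs.count_eq q

end Step

/-! ### Executions -/

section Run

variable {n : ℕ} {c : ℕ → ℕ} {A : Adversary n} {s₀ : Config n} {ω : Coins n}

theorem run_congr {ω' : Coins n} {t : ℕ} (h : ∀ r < t, ω r = ω' r) :
    run c A s₀ ω t = run c A s₀ ω' t := by
  induction t with
  | zero => rfl
  | succ t ih => simp only [run, ih fun r hr => h r (by omega), h t (by omega)]

theorem past_run (c : ℕ → ℕ) (A : Adversary n) (s₀ : Config n) (t : ℕ) :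
    Past t (fun ω => run c A s₀ ω t) :=
  fun _ _ h => run_congr h

theorem run_update {t r : ℕ} (h : r ≤ t) (u : Coin n) :
    run c A s₀ (Function.update ω t u) r = run c A s₀ ω r :=
  (past_run c A s₀ r).update h ω u

theorem run_succ_update (t : ℕ) (u : Coin n) :
    run c A s₀ (Function.update ω t u) (t + 1) =
      step c A (A.schedule t) u (run c A s₀ ω t) := by
  simp only [run, run_update le_rfl, Function.update_self]

theorem IsInitial.consistent (h : IsInitial A s₀) :
    Consistent A (fun q => if (s₀.proc q).held.isSome then 1 else 0) s₀ where
  alternating := h.alternating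
  held_inj := h.held_inj
  mem_iff := h.mem_iff
  count_eq := fun q => by simp [h.pc_eq q]

theorem IsInitial.consistent_run (h : IsInitial A s₀) (ω : Coins n) (t : ℕ) :
    Consistent A (fun q => if (s₀.proc q).held.isSome then 1 else 0) (run c A s₀ ω t) := by
  induction t with
  | zero => exact h.consistent
  | succ t ih => exact ih.step

theorem pc_mono (q : Fin n) {t t' : ℕ} (h : t ≤ t') :
    ((run c A s₀ ω t).proc q).pc ≤ ((run c A s₀ ω t').proc q).pc := by
  induction t', h using Nat.le_induction with
  | base => exact le_rfl
  | succ t' _ ih => exact ih.trans (pc_step q).1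

theorem pc_le_add (q : Fin n) (t d : ℕ) :
    ((run c A s₀ ω (t + d)).proc q).pc ≤ ((run c A s₀ ω t).proc q).pc + d := by
  induction d with
  | zero => exact le_rfl
  | succ d ih =>
    have := (pc_step (c := c) (A := A) (p := A.schedule (t + d)) (u := ω (t + d))
      (s := run c A s₀ ω (t + d)) q).2
    rw [← add_assoc, run]
    omega

theorem mid_run (q : Fin n) {t t' : ℕ} (h : t ≤ t') (hm : ((run c A s₀ ω t).proc q).Mid)
    (hpc : ((run c A s₀ ω t').proc q).pc = ((run c A s₀ ω t).proc q).pc) :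
    ((run c A s₀ ω t').proc q).Mid := by
  induction t', h using Nat.le_induction with
  | base => exact hm
  | succ t' ht ih =>
    have h1 := pc_mono (c := c) (A := A) (s₀ := s₀) (ω := ω) q ht
    have h2 := pc_mono (c := c) (A := A) (s₀ := s₀) (ω := ω) q (Nat.le_succ t')
    have h3 : ((run c A s₀ ω t').proc q).pc = ((run c A s₀ ω t).proc q).pc := by
      simp only [Nat.succ_eq_add_one] at h2
      omega
    exact mid_step (ih h3) (by rw [h3, ← hpc]; rfl)

/-- In state `l`, process `q` holds an index or is in the middle of a `get`. -/
def Busy (A : Adversary n) (q : Fin n) (l : ProcState) : Prop :=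
  l.held.isSome ∨ (A.input q l.pc = Op.get ∧ l.Mid)

/-- Compactness counts time from the initiation of a `get`, whereas the windows below open at
arbitrary times. Being busy starts only with the initiation of a `get` or at time 0, and only a
`free` ends it, so a busy state can be traced back to one of these two origins. -/
theorem busy_origin (hA : IsInitial A s₀) (q : Fin n) (τ : ℕ)
    (hb : Busy A q ((run c A s₀ ω τ).proc q)) :
    (∃ r < τ, A.input q ((run c A s₀ ω r).proc q).pc = Op.get ∧
        Initiates c A s₀ ω q ((run c A s₀ ω r).proc q).pc r ∧
        ∀ t, r < t → t < τ → ¬ ExecutesFree c A s₀ ω q t) ∨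
      (Engaged A s₀ q ∧ ∀ t < τ, ¬ ExecutesFree c A s₀ ω q t) := by
  induction τ with
  | zero => exact Or.inr ⟨hb, by simp⟩
  | succ τ ih =>
    have extend : Busy A q ((run c A s₀ ω τ).proc q) → ¬ ExecutesFree c A s₀ ω q τ →
        (∃ r < τ + 1, A.input q ((run c A s₀ ω r).proc q).pc = Op.get ∧
          Initiates c A s₀ ω q ((run c A s₀ ω r).proc q).pc r ∧
          ∀ t, r < t → t < τ + 1 → ¬ ExecutesFree c A s₀ ω q t) ∨
        (Engaged A s₀ q ∧ ∀ t < τ + 1, ¬ ExecutesFree c A s₀ ω q t) := by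
      intro h1 h2
      have key : ∀ t, t < τ + 1 → (t < τ → ¬ ExecutesFree c A s₀ ω q t) →
          ¬ ExecutesFree c A s₀ ω q t := by
        intro t ht h
        rcases Nat.lt_succ_iff_lt_or_eq.1 ht with h' | rfl
        · exact h h'
        · exact h2
      rcases ih h1 with ⟨r, hr, ha, hi, hf⟩ | ⟨he, hf⟩
      · exact Or.inl ⟨r, by omega, ha, hi, fun t h3 h4 => key t h4 (hf t h3)⟩
      · exact Or.inr ⟨he, fun t h4 => key t h4 (hf t)⟩
    by_cases hq : A.schedule τ = q
    · rw [run] at hb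
      subst hq
      have hcons := hA.consistent_run (c := c) ω τ
      rcases step_cases c A (A.schedule τ) (ω τ) (run c A s₀ ω τ) with
        ⟨hi, -, -, h2⟩ | ⟨hi, -, -, h2⟩ | ⟨hi, h1, h2⟩ | ⟨hi, -, h1, h2⟩ | ⟨hi, h1, h2⟩
      · by_cases hm : ((run c A s₀ ω τ).proc (A.schedule τ)).Mid
        · exact extend (Or.inr ⟨hi, hm⟩) fun h => by have := h.2; simp [hi] at this
        · simp only [ProcState.Mid, not_or, not_not] at hm
          exact Or.inl ⟨τ, by omega, hi, ⟨rfl, rfl, hm.1, hm.2⟩, fun t h3 h4 => by omega⟩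
      · by_cases hm : ((run c A s₀ ω τ).proc (A.schedule τ)).Mid
        · exact extend (Or.inr ⟨hi, hm⟩) fun h => by have := h.2; simp [hi] at this
        · simp only [ProcState.Mid, not_or, not_not] at hm
          exact Or.inl ⟨τ, by omega, hi, ⟨rfl, rfl, hm.1, hm.2⟩, fun t h3 h4 => by omega⟩
      · rw [h2] at hb
        simp [Busy, nextOp, ProcState.Mid] at hb
      · rw [h2] at hb
        refine extend (Or.inl ?_) fun h => by have := h.2; simp [hi] at this
        simpa [Busy, hi] using hb
      · rw [h2] at hb
        refine extend (Or.inl ?_) fun h => by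
          have := h.2
          rcases hi with ⟨hi, -⟩ | hi <;> simp [hi] at this
        simpa [Busy, nextOp, ProcState.Mid] using hb
    · rw [run, step_proc_of_ne (Ne.symm hq)] at hb
      exact extend hb fun h => hq h.1

/-- In a compact execution, a process that is busy executes a `free` soon. -/
theorem CompactSchedule.exists_free {B : ℝ} (hc : CompactSchedule c A s₀ B) (hA : IsInitial A s₀)
    (q : Fin n) (τ : ℕ) (hb : Busy A q ((run c A s₀ ω τ).proc q)) :
    ∃ t, τ ≤ t ∧ t < τ + ⌈(n : ℝ) ^ B⌉₊ ∧ ExecutesFree c A s₀ ω q t := by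
  rcases busy_origin hA q τ hb with ⟨r, hr, ha, hi, hf⟩ | ⟨he, hf⟩
  · obtain ⟨t, h1, h2, h3⟩ := hc.1 ω q _ r ha hi
    refine ⟨t, ?_, ?_, h3⟩
    · by_contra h
      exact hf t h1 (by omega) h3
    · have : (t : ℝ) < ((r + ⌈(n : ℝ) ^ B⌉₊ : ℕ) : ℝ) := by
        push_cast
        linarith [Nat.le_ceil ((n : ℝ) ^ B)]
      have := Nat.cast_lt.1 this
      omega
  · obtain ⟨t, h2, h3⟩ := hc.2 ω q he
    refine ⟨t, ?_, ?_, h3⟩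
    · by_contra h
      exact hf t (by omega) h3
    · have : (t : ℝ) < ((⌈(n : ℝ) ^ B⌉₊ : ℕ) : ℝ) := h2.trans_le (Nat.le_ceil _)
      have := Nat.cast_lt.1 this
      omega

theorem not_busy_emptyConfig (A : Adversary n) (q : Fin n) :
    ¬ Busy A q ((emptyConfig n).proc q) := by
  simp [Busy, emptyConfig, ProcState.Mid]

theorem pc_lt_of_executesFree {q : Fin n} {t t' : ℕ} (h : ExecutesFree c A s₀ ω q t)
    (ht : t < t') : ((run c A s₀ ω t).proc q).pc < ((run c A s₀ ω t').proc q).pc := by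
  refine lt_of_lt_of_le ?_ (pc_mono q (Nat.succ_le_of_lt ht))
  obtain ⟨h1, h2⟩ := h
  subst h1
  rw [Nat.succ_eq_add_one, run, step_of_free h2]
  simp [nextOp]

end Run

/-! ### Layout and loads of the batches -/

theorem batchStart_succ (n b : ℕ) : batchStart n (b + 1) = batchStart n b + batchSize n b :=
  Finset.sum_range_succ _ _

theorem batchStart_mono (n : ℕ) : Monotone (batchStart n) :=
  monotone_nat_of_le_succ fun b => by rw [batchStart_succ]; omega

theorem batchStart_le (n b : ℕ) : batchStart n b ≤ 2 * n := by
  -- The sizes telescope: each further batch has half the size of the remainder. In particular no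
  -- backup index, which is at least `2 * n`, lies in a batch.
  have key : ∀ j, batchStart n (j + 1) + n / 2 ^ (j + 1) ≤ 3 * n / 2 + n / 2 := by
    intro j
    induction j with
    | zero => simp [batchStart, batchSize]
    | succ j ih =>
      rw [batchStart_succ, batchSize, if_neg (by omega)]
      have : n / 2 ^ (j + 1 + 1) = n / 2 ^ (j + 1) / 2 := by
        rw [pow_succ, Nat.div_div_eq_div_mul]
      omega
  have h1 := key b
  have h2 := batchStart_mono n (Nat.le_succ b)
  simp only [Nat.succ_eq_add_one] at h2
  generalize n / 2 ^ (b + 1) = e at h1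
  omega

/-- Location `x` belongs to batch `b`. -/
def InBatch (n b x : ℕ) : Prop := batchStart n b ≤ x ∧ x < batchStart n (b + 1)

theorem InBatch.unique {n b b' x : ℕ} (h : InBatch n b x) (h' : InBatch n b' x) : b = b' := by
  by_contra hne
  rcases Nat.lt_or_gt_of_ne hne with hlt | hlt
  · have := batchStart_mono n (Nat.succ_le_of_lt hlt)
    have h1 := h.2
    have h2 := h'.1
    simp only [Nat.succ_eq_add_one] at this
    omega
  · have := batchStart_mono n (Nat.succ_le_of_lt hlt)
    have h1 := h'.2
    have h2 := h.1
    simp only [Nat.succ_eq_add_one] at this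
    omega

theorem probeLoc_inBatch {n b : ℕ} (hb : b < numBatches n) (u : Coin n) (k : ℕ) :
    InBatch n b (probeLoc n u b k) := by
  rw [InBatch, probeLoc, dif_pos hb, batchStart_succ]
  have := (u ⟨b, hb⟩).isLt
  constructor
  · omega
  · simp

theorem not_inBatch_probeLoc {n b l : ℕ} (hne : b ≠ l) (u : Coin n) (k : ℕ) :
    ¬ InBatch n l (probeLoc n u b k) := by
  intro h
  by_cases hb : b < numBatches n
  · exact hne ((probeLoc_inBatch hb u k).unique h)
  · rw [InBatch, probeLoc, dif_neg hb] at h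
    have := batchStart_le n (l + 1)
    omega

/-- Number of slots of batch `b` that are set. -/
def load {n : ℕ} (b : ℕ) (s : Config n) : ℕ :=
  ((Finset.range (batchSize n b)).filter fun x => s.mem (batchStart n b + x) = true).card

theorem coinLaw_lost {n b : ℕ} (hb : b < numBatches n) (s : Config n) (k : ℕ) :
    coinLaw n {u | s.mem (probeLoc n u b k) = true} = load b s / (batchSize n b : ℝ≥0∞) := by
  have := coinLaw_apply (n := n) ⟨b, hb⟩ (fun x => s.mem (batchStart n b + x) = true)
  rw [load, ← this]
  congr 1
  ext u
  simp [probeLoc, hb]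

open Classical in
/-- The occupied slots of a batch are held by distinct processes. -/
theorem Consistent.load_le {n : ℕ} {A : Adversary n} {h : Fin n → ℕ} {s : Config n}
    (hs : Consistent A h s) (b : ℕ) :
    load b s ≤ (Finset.univ.filter fun q => ∃ x, (s.proc q).held = some x ∧ InBatch n b x).card := by
  have hex : ∀ x ∈ (Finset.range (batchSize n b)).filter
      (fun x => s.mem (batchStart n b + x) = true),
      ∃ q, (s.proc q).held = some (batchStart n b + x) := by
    intro x hx
    rw [Finset.mem_filter] at hx
    exact (hs.mem_iff _).1 hx.2
  rcases isEmpty_or_nonempty (Fin n) with hn | hn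
  · rw [load, Finset.card_eq_zero.2]
    · exact Nat.zero_le _
    · exact Finset.eq_empty_of_forall_notMem fun x hx => hn.elim (hex x hx).choose
  choose! φ hφ using hex
  refine Finset.card_le_card_of_injOn φ (fun x hx => ?_) (fun x hx y hy hxy => ?_)
  · have h1 := hφ x hx
    simp only [Finset.mem_coe, Finset.mem_filter, Finset.mem_range] at hx
    simp only [Finset.coe_filter, Finset.mem_univ, true_and, Set.mem_ofPred_eq]
    exact ⟨_, h1, by rw [InBatch, batchStart_succ]; omega⟩
  · have h1 := hφ x hx
    have h2 := hφ y hy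
    rw [hxy, h2, Option.some.injEq] at h1
    omega

theorem Consistent.load_le_card {n : ℕ} {A : Adversary n} {h : Fin n → ℕ} {s : Config n}
    (hs : Consistent A h s) (b : ℕ) : load b s ≤ n := by
  classical
  refine (hs.load_le b).trans ((Finset.card_le_univ _).trans ?_)
  simp

/-! ### A potential for the occupancy of one batch

For a fixed time `T` and a batch `a + 1`, the potential of a process bounds the probability that
it holds a slot of this batch at time `T`, provided that each probe of batch `a` is lost with
probability at most `f`. -/

section Potential

variable {n : ℕ} (c : ℕ → ℕ) (A : Adversary n) (q : Fin n) (a : ℕ) (f : ℝ≥0∞)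

/-- Starting from position `pc` with `trial` reads done, `q` takes `R` steps. The value is `0` if
`q` does not execute a `free`, and otherwise one more than the number of steps left after it. -/
def slack : ℕ → ℕ → ℕ → ℕ
  | 0, _, _ => 0
  | R + 1, pc, trial =>
    match A.input q pc with
    | Op.get => 0
    | Op.free => R + 1
    | Op.collect => if trial + 1 < mainSize n + n then slack R pc (trial + 1) else
        slack R (pc + 1) 0
    | Op.call => slack R (pc + 1) 0

/-- Delaying the start by one step shortens the time left after the `free` by one; truncation at 0
covers the case where the `free` no longer fits. Thus during a `get`, with `Q` the slack computed as
if it won without using a step, winning at its `s`-th step from now leaves slack `Q - s`. -/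
theorem slack_sub_one (R pc trial : ℕ) :
    slack A q R pc trial = slack A q (R + 1) pc trial - 1 := by
  induction R generalizing pc trial with
  | zero =>
    rw [slack, slack]
    split
    · rfl
    · rfl
    · split_ifs <;> rfl
    · rfl
  | succ R ih =>
    rw [slack, slack]
    split
    · rfl
    · rfl
    · split_ifs
      · exact ih _ _
      · exact ih _ _
    · exact ih _ _

theorem slack_le (R pc trial : ℕ) : slack A q R pc trial ≤ R := by
  induction R generalizing pc trial with
  | zero => simp [slack]
  | succ R ih =>
    have h1 := slack_sub_one A q R pc trial
    have h2 := ih pc trial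
    omega

/-- Number of trials to lose before leaving batch `b`, after `k` losses. -/
def trialsLeft (b k : ℕ) : ℕ := max 1 (c b - k)

/-- Number of trials to lose before leaving batch `a + 1`, after `k` losses in batch `b`. -/
def stepsLeft (b k : ℕ) : ℕ := trialsLeft c b k + ∑ j ∈ Finset.Ioc b (a + 1), c j

/-- Number of trials in the batches up to `a + 1`. -/
def trialsUpTo : ℕ := ∑ b ∈ Finset.range (a + 2), c b

/-- A bound for the probability of losing the remaining trials in batch `a`. -/
noncomputable def reachBound (b k : ℕ) : ℝ≥0∞ :=
  if b < a then f ^ c a else if b = a then f ^ trialsLeft c a k else 1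

/-- The potential in the middle of a `get`. -/
noncomputable def getBound (b k Q : ℕ) : ℝ≥0∞ :=
  -- In the first case a win in batch `a + 1` is impossible or is followed by a `free` before the
  -- end, so only later gets count. In the second case either this `get` gets through batch `a`, or
  -- it wins early and at most `Q - 1` steps remain after the next `free`.
  if a + 1 < b ∨ stepsLeft c a b k < Q then f ^ c a * (trialsUpTo c a : ℕ)
  else reachBound c a f b k + f ^ c a * (Q - 1 : ℕ)

open Classical in
/-- The potential of a process that holds `x`. -/
noncomputable def holdBound (Q x : ℕ) : ℝ≥0∞ :=
  if Q = 0 then (if InBatch n (a + 1) x then 1 else 0)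
  else f ^ c a * (min (Q - 1) (trialsUpTo c a) : ℕ)

open Classical in
/-- The potential of a process that takes `R` more steps, and that executed a `free` already. -/
noncomputable def freshPotential (R : ℕ) (l : ProcState) : ℝ≥0∞ :=
  match l.held with
  | some x => holdBound (n := n) c a f (slack A q R l.pc l.trial) x
  | none =>
    if A.input q l.pc = Op.get ∧ l.Mid then
      getBound c a f l.batch l.trial (slack A q R (l.pc + 1) 0)
    else f ^ c a * (min R (trialsUpTo c a) : ℕ)

/-- From state `z` to state `l`, process `q` was busy and executed no `free`. -/
def Stale (z l : ProcState) : Prop :=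
  Busy A q z ∧ ∀ j, z.pc ≤ j → j < l.pc → A.input q j ≠ Op.free

open Classical in
/-- The potential of a process that takes `R` more steps, and that started in state `z`. -/
noncomputable def potential (z : ProcState) (R : ℕ) (l : ProcState) : ℝ≥0∞ :=
  if Stale A q z l then f ^ c a * (trialsUpTo c a : ℕ) else freshPotential c A q a f R l

variable {c A q a f}

theorem afterLoss_of_lt {l : ProcState} (hb : l.batch < numBatches n) :
    ((afterLoss n c l).batch = l.batch ∧ (afterLoss n c l).trial = l.trial + 1 ∧
      l.trial + 1 < c l.batch) ∨
    ((afterLoss n c l).batch = l.batch + 1 ∧ (afterLoss n c l).trial = 0 ∧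
      c l.batch ≤ l.trial + 1) := by
  unfold afterLoss
  by_cases h : c l.batch ≤ l.trial + 1
  · right; simp [hb, h]
  · left; simp [h]; omega

theorem batch_le_afterLoss (l : ProcState) : l.batch ≤ (afterLoss n c l).batch := by
  unfold afterLoss; split_ifs <;> simp

/-- The `max 1` in `trialsLeft` keeps this exact when the stored trial number already exceeds `c b`,
which an arbitrary initial state permits. -/
theorem stepsLeft_afterLoss (hc : ∀ b, 1 ≤ c b) {l : ProcState} (hb : l.batch < numBatches n)
    (h' : (afterLoss n c l).batch ≤ a + 1) :
    stepsLeft c a l.batch l.trial =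
      stepsLeft c a (afterLoss n c l).batch (afterLoss n c l).trial + 1 := by
  rcases afterLoss_of_lt (c := c) hb with ⟨h1, h2, h3⟩ | ⟨h1, h2, h3⟩
  · rw [h1, h2, stepsLeft, stepsLeft, trialsLeft, trialsLeft]
    omega
  · rw [h1] at h'
    rw [h1, h2, stepsLeft, stepsLeft, trialsLeft, trialsLeft]
    have h4 : Finset.Ioc l.batch (a + 1) =
        insert (l.batch + 1) (Finset.Ioc (l.batch + 1) (a + 1)) := by
      ext x; simp only [Finset.mem_Ioc, Finset.mem_insert]; omega
    rw [h4, Finset.sum_insert (by simp)]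
    have := hc (l.batch + 1)
    omega

theorem stepsLeft_zero (hc : ∀ b, 1 ≤ c b) : stepsLeft c a 0 0 = trialsUpTo c a := by
  rw [stepsLeft, trialsUpTo, trialsLeft, Finset.range_eq_Ico,
    Finset.sum_eq_sum_Ico_succ_bot (by omega)]
  have h : Finset.Ioc 0 (a + 1) = Finset.Ico (0 + 1) (a + 2) := by
    ext x; simp only [Finset.mem_Ioc, Finset.mem_Ico]; omega
  have := hc 0
  rw [h]
  omega

theorem one_le_stepsLeft (b k : ℕ) : 1 ≤ stepsLeft c a b k := by
  rw [stepsLeft, trialsLeft]; omega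

theorem reachBound_zero (hc : ∀ b, 1 ≤ c b) : reachBound c a f 0 0 = f ^ c a := by
  unfold reachBound
  split_ifs with h1 h2
  · rfl
  · rw [trialsLeft, Nat.sub_zero, max_eq_right (hc a)]
  · omega

theorem holdBound_le_of_not_inBatch {Q x : ℕ} (h : ¬ InBatch n (a + 1) x) :
    holdBound (n := n) c a f Q x ≤ f ^ c a * (min (Q - 1) (trialsUpTo c a) : ℕ) := by
  unfold holdBound
  split_ifs
  · simp
  · exact le_rfl

theorem holdBound_le_of_pos {Q x : ℕ} (h : 0 < Q) :
    holdBound (n := n) c a f Q x ≤ f ^ c a * (min (Q - 1) (trialsUpTo c a) : ℕ) := by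
  unfold holdBound
  rw [if_neg (by omega)]

/-- A lost trial outside batch `a` does not increase the bound. -/
theorem getBound_afterLoss_le (hc : ∀ b, 1 ≤ c b) (hl : a + 1 < numBatches n)
    (hK : f ^ c a * (trialsUpTo c a : ℕ) ≤ 1) {l : ProcState} {Q : ℕ}
    (h : l.batch ≠ a ∨ stepsLeft c a l.batch l.trial < Q) :
    getBound c a f (afterLoss n c l).batch (afterLoss n c l).trial (Q - 1) ≤
      getBound c a f l.batch l.trial Q := by
  by_cases hb : a + 1 < l.batch
  · have := batch_le_afterLoss (n := n) (c := c) l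
    rw [getBound, if_pos (Or.inl (by omega)), getBound, if_pos (Or.inl hb)]
  by_cases hb' : a + 1 < (afterLoss n c l).batch
  · rw [getBound, if_pos (Or.inl hb')]
    by_cases hQ : stepsLeft c a l.batch l.trial < Q
    · rw [getBound, if_pos (Or.inr hQ)]
    · have h1 : l.batch = a + 1 := by
        rcases afterLoss_of_lt (n := n) (c := c) (l := l) (by omega) with h | h <;> omega
      rw [getBound, if_neg (by omega), reachBound, if_neg (by omega), if_neg (by omega)]
      exact hK.trans le_self_add
  have hsteps := stepsLeft_afterLoss hc (l := l) (by omega : l.batch < numBatches n)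
    (by omega : (afterLoss n c l).batch ≤ a + 1)
  have hpos := one_le_stepsLeft (c := c) (a := a) (afterLoss n c l).batch (afterLoss n c l).trial
  by_cases hQ : stepsLeft c a l.batch l.trial < Q
  · rw [getBound, if_pos (Or.inr (by omega)), getBound, if_pos (Or.inr hQ)]
  · rw [getBound, if_neg (by omega), getBound, if_neg (by omega)]
    refine add_le_add ?_ ?_
    · have hne : l.batch ≠ a := h.resolve_right hQ
      rcases afterLoss_of_lt (n := n) (c := c) (l := l) (by omega) with ⟨h1, h2, -⟩ | ⟨h1, h2, -⟩
      · simp only [reachBound, h1, hne, if_false]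
        exact le_rfl
      · rcases Nat.lt_or_ge l.batch a with hlt | hge
        · rw [reachBound, reachBound, if_pos hlt, h1, h2]
          split_ifs with h3 h4
          · exact le_rfl
          · rw [trialsLeft, Nat.sub_zero, max_eq_right (hc a)]
          · omega
        · omega
    · gcongr
      omega

theorem holdBound_probeLoc_le (u : Coin n) (b k Q : ℕ) :
    holdBound (n := n) c a f (Q - 1) (probeLoc n u b k) ≤ getBound c a f b k Q := by
  have hsteps := one_le_stepsLeft (c := c) (a := a) b k
  rw [getBound]
  split_ifs with h
  · have : holdBound (n := n) c a f (Q - 1) (probeLoc n u b k) ≤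
        f ^ c a * (min (Q - 1 - 1) (trialsUpTo c a) : ℕ) := by
      rcases h with h | h
      · exact holdBound_le_of_not_inBatch (not_inBatch_probeLoc (by omega) u k)
      · exact holdBound_le_of_pos (by omega)
    refine this.trans ?_
    gcongr
    omega
  · by_cases hb : b = a + 1
    · rw [reachBound, if_neg (by omega), if_neg (by omega)]
      by_cases hQ : Q - 1 = 0
      · rw [holdBound, if_pos hQ]
        split_ifs <;> simp
      · refine (holdBound_le_of_pos (by omega)).trans (le_trans ?_ le_add_self)
        gcongr
        omega
    · refine (holdBound_le_of_not_inBatch (not_inBatch_probeLoc hb u k)).trans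
        (le_trans ?_ le_add_self)
      gcongr
      omega

/-- A win in batch `a` removes the reach term altogether; this is the gain that pays for the growth
of the reach term after a loss. -/
theorem holdBound_probeLoc_le' (u : Coin n) (k Q : ℕ) :
    holdBound (n := n) c a f (Q - 1) (probeLoc n u a k) ≤ f ^ c a * (Q - 1 : ℕ) := by
  refine (holdBound_le_of_not_inBatch (not_inBatch_probeLoc (by omega) u k)).trans ?_
  gcongr
  omega

theorem getBound_afterLoss_le' (hc : ∀ b, 1 ≤ c b) (hl : a + 1 < numBatches n)
    {l : ProcState} {Q : ℕ} (hb : l.batch = a) (h : ¬ stepsLeft c a l.batch l.trial < Q) :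
    getBound c a f (afterLoss n c l).batch (afterLoss n c l).trial (Q - 1) ≤
      f ^ (trialsLeft c a l.trial - 1) + f ^ c a * (Q - 1 : ℕ) := by
  have hcases := afterLoss_of_lt (n := n) (c := c) (l := l) (by omega)
  have hsteps := stepsLeft_afterLoss hc (l := l) (by omega : l.batch < numBatches n)
    (by omega : (afterLoss n c l).batch ≤ a + 1)
  rw [getBound, if_neg (by omega)]
  refine add_le_add ?_ ?_
  · rcases hcases with ⟨h1, h2, h3⟩ | ⟨h1, h2, h3⟩
    · rw [h1, h2, hb, reachBound, if_neg (by omega), if_pos rfl]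
      rw [hb] at h3
      have : trialsLeft c a (l.trial + 1) = trialsLeft c a l.trial - 1 := by
        rw [trialsLeft, trialsLeft]; omega
      rw [this]
    · rw [h1, hb, reachBound, if_neg (by omega), if_neg (by omega)]
      rw [hb] at h3
      have : trialsLeft c a l.trial - 1 = 0 := by
        rw [trialsLeft]; omega
      rw [this, pow_zero]
  · gcongr
    omega

/-- Starting a `get` uses up one of the at most `trialsUpTo c a` gets that may be decisive: its
reach term `f ^ c a` and the `Q - 1` copies for later gets make `Q` copies. If `Q` exceeds
`trialsUpTo c a`, this `get` is not decisive and the capped value is unchanged. -/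
theorem getBound_zero_le (hc : ∀ b, 1 ≤ c b) {R Q : ℕ} (hQ : Q ≤ R + 1) :
    getBound c a f 0 0 Q ≤ f ^ c a * (min (R + 1) (trialsUpTo c a) : ℕ) := by
  have hs := stepsLeft_zero (c := c) (a := a) hc
  have hpos := one_le_stepsLeft (c := c) (a := a) 0 0
  rw [getBound]
  split_ifs with h
  · gcongr
    omega
  · rw [reachBound_zero hc]
    calc f ^ c a + f ^ c a * (Q - 1 : ℕ) = f ^ c a * (Q - 1 + 1 : ℕ) := by
          push_cast; ring
      _ ≤ _ := by gcongr; omega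

theorem lintegral_le_of_le {g : Coin n → ℝ≥0∞} {x : ℝ≥0∞} (h : ∀ u, g u ≤ x) :
    ∫⁻ u, g u ∂(coinLaw n) ≤ x := by
  refine (lintegral_mono h).trans ?_
  simp

/-- The expected value of the bound after one trial of a `get`. -/
theorem lintegral_getBound_le (hc : ∀ b, 1 ≤ c b) (hl : a + 1 < numBatches n)
    (hK : f ^ c a * (trialsUpTo c a : ℕ) ≤ 1) {s : Config n}
    (hf : (load a s : ℝ≥0∞) / (batchSize n a : ℝ≥0∞) ≤ f) (l : ProcState) (Q : ℕ) :
    ∫⁻ u, (if s.mem (probeLoc n u l.batch l.trial) = true then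
        getBound c a f (afterLoss n c l).batch (afterLoss n c l).trial (Q - 1)
      else holdBound (n := n) c a f (Q - 1) (probeLoc n u l.batch l.trial)) ∂(coinLaw n) ≤
      getBound c a f l.batch l.trial Q := by
  by_cases h : l.batch ≠ a ∨ stepsLeft c a l.batch l.trial < Q
  · refine lintegral_le_of_le fun u => ?_
    split_ifs
    · exact getBound_afterLoss_le hc hl hK h
    · exact holdBound_probeLoc_le u _ _ _
  -- The critical case: the trial takes place in batch `a` and the `get` may still be decisive. The
  -- reach term grows by a factor `1 / f` on a loss, which has probability at most `f`.
  · push Not at h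
    obtain ⟨hb, hQ⟩ := h
    have h1 := getBound_afterLoss_le' (f := f) hc hl hb (not_lt.2 hQ)
    rw [hb] at hQ
    rw [hb]
    have hS : MeasurableSet {u : Coin n | s.mem (probeLoc n u a l.trial) = true} :=
      Set.Finite.measurableSet (Set.toFinite _)
    calc _ ≤ ∫⁻ u, (f ^ c a * (Q - 1 : ℕ) +
          {u : Coin n | s.mem (probeLoc n u a l.trial) = true}.indicator
            (fun _ => f ^ (trialsLeft c a l.trial - 1)) u) ∂(coinLaw n) := by
          refine lintegral_mono fun u => ?_
          dsimp only
          split_ifs with hu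
          · rw [Set.indicator_of_mem (by exact hu), add_comm]
            exact h1
          · rw [Set.indicator_of_notMem (by exact hu), add_zero]
            exact holdBound_probeLoc_le' u _ _
      _ = f ^ c a * (Q - 1 : ℕ) + f ^ (trialsLeft c a l.trial - 1) *
            coinLaw n {u : Coin n | s.mem (probeLoc n u a l.trial) = true} := by
          rw [lintegral_add_left measurable_const, lintegral_const, measure_univ, mul_one,
            lintegral_indicator_const hS]
      _ ≤ f ^ c a * (Q - 1 : ℕ) + f ^ (trialsLeft c a l.trial - 1) * f := by
          rw [coinLaw_lost (by omega)]
          gcongr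
      _ = getBound c a f a l.trial Q := by
          rw [getBound, if_neg (by omega), reachBound, if_neg (by omega), if_pos rfl, ← pow_succ,
            Nat.sub_add_cancel (by rw [trialsLeft]; omega), add_comm]

theorem Stale.step {z l l' : ProcState} (h : Stale A q z l) (hf : A.input q l.pc ≠ Op.free)
    (hpc : l'.pc ≤ l.pc + 1) : Stale A q z l' := by
  refine ⟨h.1, fun j h1 h2 => ?_⟩
  rcases Nat.lt_or_ge j l.pc with h3 | h3
  · exact h.2 j h1 h3
  · have : j = l.pc := by omega
    exact this ▸ hf

theorem Stale.of_le {z l l' : ProcState} (h : Stale A q z l') (hpc : l.pc ≤ l'.pc) :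
    Stale A q z l :=
  ⟨h.1, fun j h1 h2 => h.2 j h1 (h2.trans_le hpc)⟩

theorem freshPotential_of_held (R : ℕ) {l : ProcState} {x : ℕ} (h : l.held = some x) :
    freshPotential c A q a f R l = holdBound (n := n) c a f (slack A q R l.pc l.trial) x := by
  simp only [freshPotential, h]

theorem freshPotential_of_get (R : ℕ) {l : ProcState} (h : l.held = none)
    (hi : A.input q l.pc = Op.get) (hm : l.Mid) :
    freshPotential c A q a f R l =
      getBound c a f l.batch l.trial (slack A q R (l.pc + 1) 0) := by
  simp only [freshPotential, h, hi, hm, and_self, if_true]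

theorem freshPotential_of_idle (R : ℕ) {l : ProcState} (h : l.held = none)
    (hi : ¬ (A.input q l.pc = Op.get ∧ l.Mid)) :
    freshPotential c A q a f R l = f ^ c a * (min R (trialsUpTo c a) : ℕ) := by
  simp only [freshPotential, h, hi, if_false]

theorem freshPotential_nextOp_none (R : ℕ) (l : ProcState) :
    freshPotential c A q a f R (nextOp l none) = f ^ c a * (min R (trialsUpTo c a) : ℕ) :=
  freshPotential_of_idle R rfl (by simp [nextOp, ProcState.Mid])

/-- A step of `q` does not increase the expected potential, if batch `a` is not overcrowded. -/
theorem lintegral_potential_step {h : Fin n → ℕ} {s : Config n} (hs : Consistent A h s)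
    (hc : ∀ b, 1 ≤ c b) (hl : a + 1 < numBatches n) (hK : f ^ c a * (trialsUpTo c a : ℕ) ≤ 1)
    (hf : (load a s : ℝ≥0∞) / (batchSize n a : ℝ≥0∞) ≤ f) (z : ProcState) (R : ℕ) :
    ∫⁻ u, potential c A q a f z R ((step c A q u s).proc q) ∂(coinLaw n) ≤
      potential c A q a f z (R + 1) (s.proc q) := by
  by_cases hst : Stale A q z (s.proc q)
  · refine lintegral_le_of_le fun u => ?_
    rw [potential, potential, if_pos hst]
    split_ifs with hst'
    · exact le_rfl
    -- Staleness ends only with a `free`, and then the idle value is at most the constant assigned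
    -- to stale states.
    · by_cases hi : A.input q (s.proc q).pc = Op.free
      · rw [step_of_free hi]
        simp only [Function.update_self, freshPotential_nextOp_none]
        gcongr
        omega
      · exact absurd (hst.step hi (pc_step q).2) hst'
  -- Staleness concerns only completed operations, so once lost it never returns.
  have hst' : ∀ u, ¬ Stale A q z ((step c A q u s).proc q) :=
    fun u h' => hst (h'.of_le (pc_step q).1)
  simp only [potential, if_neg hst, if_neg (hst' _)]
  set l := s.proc q with hldef
  cases hi : A.input q l.pc with
  | get =>
    have hnone : l.held = none := hs.held_of_get hi
    have h1 : ∀ u, freshPotential c A q a f R ((step c A q u s).proc q) =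
        if s.mem (probeLoc n u l.batch l.trial) = true then
          getBound c a f (afterLoss n c l).batch (afterLoss n c l).trial
            (slack A q (R + 1) (l.pc + 1) 0 - 1)
        else holdBound (n := n) c a f (slack A q (R + 1) (l.pc + 1) 0 - 1)
          (probeLoc n u l.batch l.trial) := by
      intro u
      rw [← slack_sub_one]
      rcases step_cases c A q u s with ⟨-, hm, -, h2⟩ | ⟨-, hm, -, h2⟩ | ⟨hi', -⟩ | ⟨hi', -⟩ |
        ⟨hi', -⟩
      · rw [h2, if_pos hm, freshPotential_of_get R (by rw [afterLoss_held]; exact hnone)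
          (by rw [afterLoss_pc]; exact hi) (afterLoss_mid _), afterLoss_pc]
      · rw [h2, if_neg (by rw [hm]; exact Bool.false_ne_true), freshPotential_of_held R rfl]
        rfl
      · simp [← hldef, hi] at hi'
      · simp [← hldef, hi] at hi'
      · simp [← hldef, hi] at hi'
    simp only [h1]
    refine (lintegral_getBound_le hc hl hK hf l _).trans ?_
    by_cases hmid : l.Mid
    · rw [freshPotential_of_get _ hnone hi hmid]
    · rw [freshPotential_of_idle _ hnone fun h' => hmid h'.2]
      simp only [ProcState.Mid, not_or, not_not] at hmid
      rw [hmid.1, hmid.2]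
      exact getBound_zero_le hc (slack_le _ _ _ _ _)
  | free =>
    obtain ⟨x, hx⟩ := hs.held_of_free hi
    refine lintegral_le_of_le fun u => ?_
    rw [step_of_free hi]
    simp only [Function.update_self, freshPotential_nextOp_none]
    rw [freshPotential_of_held _ hx, slack]
    simp only [← hldef, hi]
    rw [holdBound, if_neg (by omega), Nat.add_sub_cancel]
  | collect =>
    refine lintegral_le_of_le fun u => ?_
    have hidle : ¬ (A.input q l.pc = Op.get ∧ l.Mid) := by simp [hi]
    rcases step_cases c A q u s with ⟨hi', -⟩ | ⟨hi', -⟩ | ⟨hi', -⟩ | ⟨-, ht, -, h2⟩ |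
      ⟨⟨-, ht⟩ | hi', -, h2⟩
    · simp [← hldef, hi] at hi'
    · simp [← hldef, hi] at hi'
    · simp [← hldef, hi] at hi'
    · rw [h2, ← hldef]
      rw [← hldef] at ht
      cases hx : l.held with
      | some x =>
        rw [freshPotential_of_held (x := x) _ hx, freshPotential_of_held (x := x) _ (by exact hx), slack]
        simp only [hi, ht, if_true]
        exact le_rfl
      | none =>
        rw [freshPotential_of_idle _ hx hidle, freshPotential_of_idle _ (by exact hx) (by simp [hi])]
        gcongr
        omega
    · rw [h2, ← hldef]
      rw [← hldef] at ht
      cases hx : l.held with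
      | some x =>
        rw [freshPotential_of_held (x := x) _ hx, freshPotential_of_held (x := x) _ (by rfl), slack]
        simp only [hi, ht, if_false]
        exact le_rfl
      | none =>
        rw [freshPotential_of_idle _ hx hidle, freshPotential_nextOp_none]
        gcongr
        omega
    · simp [← hldef, hi] at hi'
  | call =>
    refine lintegral_le_of_le fun u => ?_
    rw [step_of_call hi]
    simp only [Function.update_self]
    rw [← hldef]
    cases hx : l.held with
    | some x =>
      rw [freshPotential_of_held (x := x) _ hx, freshPotential_of_held (x := x) _ (by rfl), slack]
      simp only [hi]
      exact le_rfl
    | none =>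
      rw [freshPotential_of_idle _ hx (by simp [hi]), freshPotential_nextOp_none]
      gcongr
      omega

theorem potential_le_of_not_busy {z : ProcState} (R : ℕ) (hz : ¬ Busy A q z) :
    potential c A q a f z R z ≤ f ^ c a * (trialsUpTo c a : ℕ) := by
  simp only [Busy, not_or, Option.not_isSome_iff_eq_none] at hz
  rw [potential]
  split_ifs
  · exact le_rfl
  · rw [freshPotential]
    simp only [hz.1, hz.2, if_false]
    gcongr
    omega

/-- The bound is independent of the state at the start of the window: a busy process counts as
stale, so nothing need be known about where it is. -/
theorem potential_start_le (z : ProcState) (R : ℕ) :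
    potential c A q a f z R z ≤ f ^ c a * (trialsUpTo c a : ℕ) := by
  by_cases hz : Busy A q z
  · rw [potential, if_pos ⟨hz, fun j h1 h2 => by omega⟩]
  · exact potential_le_of_not_busy R hz

theorem one_le_potential_of_inBatch {z l : ProcState} (hst : ¬ Stale A q z l) {x : ℕ}
    (hx : l.held = some x) (hb : InBatch n (a + 1) x) : 1 ≤ potential c A q a f z 0 l := by
  rw [potential, if_neg hst, freshPotential]
  simp [hx, holdBound, slack, hb]

end Potential

/-! ### Concentration of the load of a batch -/

section Concentration

variable {n : ℕ} {c : ℕ → ℕ} {A : Adversary n} {s₀ : Config n} {a : ℕ} {f : ℝ≥0∞}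

/-- Number of steps of `q` in the time interval `[t, T)`. -/
def stepsBetween (A : Adversary n) (q : Fin n) (t T : ℕ) : ℕ :=
  ((Finset.Ico t T).filter fun r => A.schedule r = q).card

theorem stepsBetween_self_of_eq {q : Fin n} {t T : ℕ} (ht : t < T) (h : A.schedule t = q) :
    stepsBetween A q t T = stepsBetween A q (t + 1) T + 1 := by
  rw [stepsBetween, stepsBetween, ← Finset.insert_Ico_succ_left_eq_Ico ht, Finset.filter_insert,
    if_pos h, Finset.card_insert_of_notMem (by simp)]
  rfl

theorem stepsBetween_of_ne {q : Fin n} {t T : ℕ} (ht : t < T) (h : A.schedule t ≠ q) :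
    stepsBetween A q t T = stepsBetween A q (t + 1) T := by
  rw [stepsBetween, stepsBetween, ← Finset.insert_Ico_succ_left_eq_Ico ht, Finset.filter_insert,
    if_neg h]
  rfl

theorem stepsBetween_self (q : Fin n) (T : ℕ) : stepsBetween A q T T = 0 := by
  simp [stepsBetween]

open Classical in
/-- The joint potential of all processes at time `t`, on the event `E` and as long as the load
of batch `a` is at most `m`. -/
noncomputable def jointPotential (c : ℕ → ℕ) (A : Adversary n) (s₀ : Config n) (a : ℕ) (f : ℝ≥0∞)
    (E : Set (Coins n)) (m τ T t : ℕ) (ω : Coins n) : ℝ≥0∞ :=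
  (if ω ∈ E ∧ ∀ r, τ ≤ r → r < t → load a (run c A s₀ ω r) ≤ m then 1 else 0) *
    ∏ q, (1 + potential c A q a f ((run c A s₀ ω τ).proc q) (stepsBetween A q t T)
      ((run c A s₀ ω t).proc q))

theorem past_jointPotential {E : Set (Coins n)} {m τ T t : ℕ} (hE : Past τ (· ∈ E)) (ht : τ ≤ t) :
    Past t (jointPotential c A s₀ a f E m τ T t) := by
  classical
  intro ω ω' h
  have h1 : (ω ∈ E) = (ω' ∈ E) := hE ω ω' fun r hr => h r (by omega)
  have h2 : ∀ r ≤ t, run c A s₀ ω r = run c A s₀ ω' r :=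
    fun r hr => run_congr fun i hi => h i (by omega)
  have h3 : (∀ r, τ ≤ r → r < t → load a (run c A s₀ ω r) ≤ m) ↔
      ∀ r, τ ≤ r → r < t → load a (run c A s₀ ω' r) ≤ m :=
    forall_congr' fun r => forall₂_congr fun _ hr => by rw [h2 r hr.le]
  simp only [jointPotential, h2 τ ht, h2 t le_rfl]
  congr 1
  exact if_congr (and_congr (iff_of_eq h1) h3) rfl rfl

/-- Given the past, only the factor of the scheduled process is random. The indicator includes time
`t` itself, which supplies the bound on the load of batch `a` for this very step; if it fails, the
new potential vanishes. -/
theorem jointPotential_step (hA : IsInitial A s₀) (hc : ∀ b, 1 ≤ c b)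
    (hl : a + 1 < numBatches n) (hK : f ^ c a * (trialsUpTo c a : ℕ) ≤ 1) {m : ℕ}
    (hf : (m : ℝ≥0∞) / (batchSize n a : ℝ≥0∞) ≤ f) {E : Set (Coins n)} {τ T t : ℕ}
    (hE : Past τ (· ∈ E)) (hτ : τ ≤ t) (hT : t < T) (ω : Coins n) :
    ∫⁻ u, jointPotential c A s₀ a f E m τ T (t + 1) (Function.update ω t u) ∂(coinLaw n) ≤
      jointPotential c A s₀ a f E m τ T t ω := by
  classical
  set p := A.schedule t with hp
  have h1 : ∀ u, (Function.update ω t u ∈ E) = (ω ∈ E) := fun u => hE.update hτ ω u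
  have h2 : ∀ u, (∀ r, τ ≤ r → r < t + 1 →
        load a (run c A s₀ (Function.update ω t u) r) ≤ m) ↔
      ∀ r, τ ≤ r → r < t + 1 → load a (run c A s₀ ω r) ≤ m := fun u =>
    forall_congr' fun r => forall₂_congr fun _ hr => by rw [run_update (by omega)]
  simp only [jointPotential, h1, h2, run_update hτ, run_succ_update, ← hp]
  by_cases hgood : ω ∈ E ∧ ∀ r, τ ≤ r → r < t + 1 → load a (run c A s₀ ω r) ≤ m
  · have hgood' : ω ∈ E ∧ ∀ r, τ ≤ r → r < t → load a (run c A s₀ ω r) ≤ m :=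
      ⟨hgood.1, fun r h3 h4 => hgood.2 r h3 (by omega)⟩
    simp only [if_pos hgood, if_pos hgood', one_mul]
    rw [← Finset.mul_prod_erase _ _ (Finset.mem_univ p)]
    have h3 : ∀ u, ∏ q, (1 + potential c A q a f ((run c A s₀ ω τ).proc q)
          (stepsBetween A q (t + 1) T) ((step c A p u (run c A s₀ ω t)).proc q)) =
        (1 + potential c A p a f ((run c A s₀ ω τ).proc p)
          (stepsBetween A p (t + 1) T) ((step c A p u (run c A s₀ ω t)).proc p)) *
        ∏ q ∈ Finset.univ.erase p, (1 + potential c A q a f ((run c A s₀ ω τ).proc q)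
          (stepsBetween A q t T) ((run c A s₀ ω t).proc q)) := by
      intro u
      rw [← Finset.mul_prod_erase _ _ (Finset.mem_univ p)]
      congr 1
      refine Finset.prod_congr rfl fun q hq => ?_
      have hne := Finset.ne_of_mem_erase hq
      rw [step_proc_of_ne hne, stepsBetween_of_ne hT (by rw [← hp]; exact hne.symm)]
    simp only [h3]
    rw [lintegral_mul_const _ (measurable_of_countable _)]
    gcongr
    rw [lintegral_add_left measurable_const, lintegral_const, measure_univ, mul_one,
      stepsBetween_self_of_eq hT hp.symm]
    gcongr
    refine lintegral_potential_step (hA.consistent_run ω t) hc hl hK ?_ _ _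
    refine le_trans ?_ hf
    gcongr
    exact hgood.2 t hτ (by omega)
  · simp only [if_neg hgood, zero_mul, lintegral_zero]
    exact zero_le

/-- Each process that holds a slot of batch `a + 1` contributes a factor 2 at time `T`, because no
process is stale any more by then. -/
theorem pow_le_jointPotential (hA : IsInitial A s₀) {E : Set (Coins n)} {m τ T M : ℕ} {ω : Coins n}
    (hfree : ∀ q, Busy A q ((run c A s₀ ω τ).proc q) →
      ∃ t, τ ≤ t ∧ t < T ∧ ExecutesFree c A s₀ ω q t)
    (hE : ω ∈ E) (hgood : ∀ r, τ ≤ r → r < T → load a (run c A s₀ ω r) ≤ m)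
    (hM : M ≤ load (a + 1) (run c A s₀ ω T)) :
    2 ^ M ≤ jointPotential c A s₀ a f E m τ T T ω := by
  classical
  rw [jointPotential, if_pos ⟨hE, hgood⟩, one_mul]
  set F := Finset.univ.filter fun q => ∃ x, ((run c A s₀ ω T).proc q).held = some x ∧
    InBatch n (a + 1) x with hF
  calc (2 : ℝ≥0∞) ^ M ≤ 2 ^ F.card := by
        refine pow_le_pow_right₀ (by norm_num) (hM.trans ?_)
        exact (hA.consistent_run ω T).load_le (a + 1)
    _ = ∏ q, if q ∈ F then 2 else 1 := by
        rw [Finset.prod_ite_mem, Finset.univ_inter, Finset.prod_const]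
    _ ≤ _ := by
        refine Finset.prod_le_prod' fun q _ => ?_
        split_ifs with hq
        · rw [hF, Finset.mem_filter] at hq
          obtain ⟨-, x, hx, hb⟩ := hq
          rw [stepsBetween_self, ← one_add_one_eq_two]
          gcongr
          refine one_le_potential_of_inBatch ?_ hx hb
          rintro ⟨h1, h2⟩
          obtain ⟨t, h3, h4, h5⟩ := hfree q h1
          exact h2 _ (pc_mono q h3) (pc_lt_of_executesFree h5 h4) h5.2
        · exact le_self_add

/-- If batch `a` is not overcrowded in `[τ, T)`, and the processes that are busy at time `τ`
execute a `free` before time `T`, then the load of batch `a + 1` at time `T` has an exponential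
tail. -/
theorem measure_load_mul_pow_le (hA : IsInitial A s₀) (hc : ∀ b, 1 ≤ c b)
    (hl : a + 1 < numBatches n) (hK : f ^ c a * (trialsUpTo c a : ℕ) ≤ 1) {m : ℕ}
    (hf : (m : ℝ≥0∞) / (batchSize n a : ℝ≥0∞) ≤ f) {E : Set (Coins n)} {τ T : ℕ}
    (hE : Past τ (· ∈ E)) (hτ : τ ≤ T)
    (hfree : ∀ ω q, Busy A q ((run c A s₀ ω τ).proc q) →
      ∃ t, τ ≤ t ∧ t < T ∧ ExecutesFree c A s₀ ω q t) (M : ℕ) :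
    coinMeasure n {ω | ω ∈ E ∧ (∀ r, τ ≤ r → r < T → load a (run c A s₀ ω r) ≤ m) ∧
        M ≤ load (a + 1) (run c A s₀ ω T)} * 2 ^ M ≤
      coinMeasure n E * (1 + f ^ c a * (trialsUpTo c a : ℕ)) ^ n := by
  classical
  have hEm : MeasurableSet E := measurableSet_setOfPred.2 (Past.measurable hE)
  set S := {ω | ω ∈ E ∧ (∀ r, τ ≤ r → r < T → load a (run c A s₀ ω r) ≤ m) ∧
        M ≤ load (a + 1) (run c A s₀ ω T)} with hS
  have hSm : MeasurableSet S := by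
    refine measurableSet_setOfPred.2 (Past.measurable (t := T) ?_)
    intro ω ω' h
    have h1 : (ω ∈ E) = (ω' ∈ E) := hE ω ω' fun r hr => h r (by omega)
    have h2 : ∀ r ≤ T, run c A s₀ ω r = run c A s₀ ω' r :=
      fun r hr => run_congr fun i hi => h i (by omega)
    have h3 : (∀ r, τ ≤ r → r < T → load a (run c A s₀ ω r) ≤ m) ↔
        ∀ r, τ ≤ r → r < T → load a (run c A s₀ ω' r) ≤ m :=
      forall_congr' fun r => forall₂_congr fun _ hr => by rw [h2 r hr.le]
    simp only [h1, h2 T le_rfl, h3]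
  -- Markov's inequality for the exponential moment of the load, in product form to avoid dividing.
  calc coinMeasure n S * 2 ^ M = ∫⁻ ω, S.indicator (fun _ => 2 ^ M) ω ∂(coinMeasure n) := by
        rw [lintegral_indicator_const hSm, mul_comm]
    _ ≤ ∫⁻ ω, jointPotential c A s₀ a f E m τ T T ω ∂(coinMeasure n) := by
        refine lintegral_mono fun ω => ?_
        by_cases hω : ω ∈ S
        · rw [Set.indicator_of_mem hω]
          exact pow_le_jointPotential hA (hfree ω) hω.1 hω.2.1 hω.2.2
        · rw [Set.indicator_of_notMem hω]
          exact zero_le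
    _ ≤ ∫⁻ ω, jointPotential c A s₀ a f E m τ T τ ω ∂(coinMeasure n) :=
        lintegral_le_of_supermartingale hτ (fun t ht => past_jointPotential hE ht)
          fun t h1 h2 ω => jointPotential_step hA hc hl hK hf hE h1 h2 ω
    _ ≤ ∫⁻ ω, E.indicator (fun _ => (1 + f ^ c a * (trialsUpTo c a : ℕ)) ^ n) ω
          ∂(coinMeasure n) := by
        refine lintegral_mono fun ω => ?_
        by_cases hω : ω ∈ E
        · rw [Set.indicator_of_mem hω, jointPotential, if_pos ⟨hω, fun r h1 h2 => by omega⟩,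
            one_mul]
          calc _ ≤ ∏ _q : Fin n, (1 + f ^ c a * (trialsUpTo c a : ℕ)) :=
                Finset.prod_le_prod' fun q _ => by
                  gcongr
                  exact potential_start_le _ _
            _ = _ := by simp
        · rw [jointPotential, if_neg fun h => hω h.1, zero_mul]
          exact zero_le
    _ = coinMeasure n E * (1 + f ^ c a * (trialsUpTo c a : ℕ)) ^ n := by
        rw [lintegral_indicator_const hEm, mul_comm]

end Concentration

/-! ### The trials of a fixed `get` in one batch -/

section SingleGet

variable {n : ℕ} {c : ℕ → ℕ} {A : Adversary n} {s₀ : Config n} {J i : ℕ} {f : ℝ≥0∞} {p : Fin n}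

/-- A bound for the probability that the operation at position `i` loses its remaining trials in
batch `J`. -/
noncomputable def passBound (c : ℕ → ℕ) (J i : ℕ) (f : ℝ≥0∞) (l : ProcState) : ℝ≥0∞ :=
  if i < l.pc then 0
  else if l.pc = i ∧ J < l.batch then 1
  else if l.pc = i ∧ J = l.batch then f ^ trialsLeft c J l.trial
  else f ^ c J

theorem passBound_le_of_not_mid (hc : ∀ b, 1 ≤ c b) {l : ProcState} (h : l.pc = i → ¬ l.Mid) :
    passBound c J i f l ≤ f ^ c J := by
  have h0 : l.pc = i → l.batch = 0 ∧ l.trial = 0 := by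
    simpa only [ProcState.Mid, not_or, not_not] using h
  rw [passBound]
  split_ifs with h1 h2 h3
  · exact zero_le
  · have := h0 h2.1
    omega
  · rw [(h0 h3.1).2, trialsLeft, Nat.sub_zero, max_eq_right (hc J)]
  · exact le_rfl

/-- In batch `J` the bound grows by `1 / f` on a loss, which has probability at most `f`, and drops
to 0 on a win; every other step of `p` leaves it no larger. The load is needed only when `p` steps
in the fixed operation. -/
theorem lintegral_passBound_step (hc : ∀ b, 1 ≤ c b) (hJ : J < numBatches n)
    (hi : A.input p i = Op.get) {s : Config n}
    (hf : (s.proc p).pc = i → (load J s : ℝ≥0∞) / (batchSize n J : ℝ≥0∞) ≤ f)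
    (hpass : (s.proc p).pc = i → (s.proc p).batch ≤ J) :
    ∫⁻ u, passBound c J i f ((step c A p u s).proc p) ∂(coinLaw n) ≤
      passBound c J i f (s.proc p) := by
  set l := s.proc p with hl
  rcases lt_trichotomy l.pc i with hlt | heq | hgt
  · refine lintegral_le_of_le fun u => ?_
    have h1 := pc_step (c := c) (A := A) (p := p) (u := u) (s := s) p
    rw [← hl] at h1
    rw [passBound.eq_def c J i f l, if_neg (by omega), if_neg (by omega), if_neg (by omega)]
    refine passBound_le_of_not_mid hc fun h2 => ?_
    exact not_mid_step (by rw [h2]; exact hlt)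
  · have hig : A.input p (s.proc p).pc = Op.get := by rw [← hl, heq, hi]
    have hb := hpass heq
    have hlost : ∀ u, s.mem (probeLoc n u l.batch l.trial) = true →
        (step c A p u s).proc p = afterLoss n c l := fun u hu => by
      rw [step_of_get_lost hig hu]; simp [hl]
    have hwon : ∀ u, ¬ s.mem (probeLoc n u l.batch l.trial) = true →
        i < ((step c A p u s).proc p).pc := fun u hu => by
      rw [step_of_get_won hig (by simpa using hu)]
      simp only [Function.update_self, nextOp, ← hl]
      omega
    have hcases := afterLoss_of_lt (n := n) (c := c) (l := l) (by omega)
    rcases hb.lt_or_eq with hb | hb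
    · refine lintegral_le_of_le fun u => ?_
      rw [passBound, passBound.eq_def c J i f l, if_neg (by omega : ¬ i < l.pc),
        if_neg (by omega : ¬ (l.pc = i ∧ J < l.batch)),
        if_neg (by omega : ¬ (l.pc = i ∧ J = l.batch))]
      by_cases hm : s.mem (probeLoc n u l.batch l.trial) = true
      · rw [hlost u hm, afterLoss_pc, if_neg (by omega), if_neg (by omega)]
        split_ifs with h4
        · have : (afterLoss n c l).trial = 0 := by omega
          rw [this, trialsLeft, Nat.sub_zero, max_eq_right (hc J)]
        · exact le_rfl
      · rw [if_pos (hwon u hm)]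
        exact zero_le
    · have hS : MeasurableSet {u : Coin n | s.mem (probeLoc n u J l.trial) = true} :=
        Set.Finite.measurableSet (Set.toFinite _)
      rw [hb] at hlost hwon hcases
      calc _ ≤ ∫⁻ u, {u : Coin n | s.mem (probeLoc n u J l.trial) = true}.indicator
              (fun _ => f ^ (trialsLeft c J l.trial - 1)) u ∂(coinLaw n) := by
            refine lintegral_mono fun u => ?_
            by_cases hu : s.mem (probeLoc n u J l.trial) = true
            · rw [Set.indicator_of_mem (by exact hu), hlost u hu, passBound, afterLoss_pc,
                if_neg (by omega)]
              rcases hcases with ⟨h1, h2, h3⟩ | ⟨h1, h2, h3⟩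
              · rw [if_neg (by omega), if_pos (by omega), h2]
                have : trialsLeft c J (l.trial + 1) = trialsLeft c J l.trial - 1 := by
                  rw [trialsLeft, trialsLeft]; omega
                rw [this]
              · rw [if_pos (by omega)]
                have : trialsLeft c J l.trial - 1 = 0 := by
                  rw [trialsLeft]; omega
                rw [this, pow_zero]
            · rw [Set.indicator_of_notMem (by exact hu), passBound, if_pos (hwon u hu)]
        _ = f ^ (trialsLeft c J l.trial - 1) *
              coinLaw n {u : Coin n | s.mem (probeLoc n u J l.trial) = true} := by
            rw [lintegral_indicator_const hS]
        _ ≤ f ^ (trialsLeft c J l.trial - 1) * f := by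
            rw [coinLaw_lost hJ]
            gcongr
            exact hf heq
        _ = passBound c J i f l := by
            rw [passBound, if_neg (by omega), if_neg (by omega), if_pos (by omega), ← pow_succ,
              Nat.sub_add_cancel (by rw [trialsLeft]; omega)]
  · refine lintegral_le_of_le fun u => ?_
    have h1 := pc_step (c := c) (A := A) (p := p) (u := u) (s := s) p
    rw [← hl] at h1
    rw [passBound, if_pos (by omega)]
    exact zero_le

open Classical in
/-- The potential for the event that the operation at position `i` leaves batch `J`. -/
noncomputable def passPotential (c : ℕ → ℕ) (A : Adversary n) (s₀ : Config n) (p : Fin n)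
    (J i : ℕ) (f : ℝ≥0∞) (E : Set (Coins n)) (m τ t : ℕ) (ω : Coins n) : ℝ≥0∞ :=
  (if ω ∈ E ∧ ∀ r, τ ≤ r → r < t → A.schedule r = p → ((run c A s₀ ω r).proc p).pc = i →
      load J (run c A s₀ ω r) ≤ m then 1 else 0) *
    (if ∃ r, τ ≤ r ∧ r ≤ t ∧ ((run c A s₀ ω r).proc p).pc = i ∧
      J < ((run c A s₀ ω r).proc p).batch then 1 else passBound c J i f ((run c A s₀ ω t).proc p))

theorem past_passPotential {E : Set (Coins n)} {m τ t : ℕ} (hE : Past τ (· ∈ E)) (ht : τ ≤ t) :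
    Past t (passPotential c A s₀ p J i f E m τ t) := by
  classical
  intro ω ω' h
  have h1 : (ω ∈ E) = (ω' ∈ E) := hE ω ω' fun r hr => h r (by omega)
  have h2 : ∀ r ≤ t, run c A s₀ ω r = run c A s₀ ω' r :=
    fun r hr => run_congr fun i hi => h i (by omega)
  rw [passPotential, passPotential, h2 t le_rfl]
  congr 1
  · refine if_congr (and_congr (iff_of_eq h1) ?_) rfl rfl
    exact forall_congr' fun r => forall₂_congr fun _ hr => by rw [h2 r hr.le]
  · refine if_congr ?_ rfl rfl
    refine exists_congr fun r => and_congr_right fun _ => and_congr_right fun hr => ?_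
    rw [h2 r hr]

/-- Passing batch `J` is recorded permanently, since `passBound` falls to 0 once the `get` completes
in a later batch. -/
theorem passPotential_step (hc : ∀ b, 1 ≤ c b) (hJ : J < numBatches n)
    (hi : A.input p i = Op.get) {m : ℕ} (hf : (m : ℝ≥0∞) / (batchSize n J : ℝ≥0∞) ≤ f)
    {E : Set (Coins n)} {τ t : ℕ} (hE : Past τ (· ∈ E)) (hτ : τ ≤ t) (ω : Coins n) :
    ∫⁻ u, passPotential c A s₀ p J i f E m τ (t + 1) (Function.update ω t u) ∂(coinLaw n) ≤
      passPotential c A s₀ p J i f E m τ t ω := by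
  classical
  by_cases hgood : ω ∈ E ∧ ∀ r, τ ≤ r → r < t + 1 → A.schedule r = p →
      ((run c A s₀ ω r).proc p).pc = i → load J (run c A s₀ ω r) ≤ m
  · have hgood' : ω ∈ E ∧ ∀ r, τ ≤ r → r < t → A.schedule r = p →
        ((run c A s₀ ω r).proc p).pc = i → load J (run c A s₀ ω r) ≤ m :=
      ⟨hgood.1, fun r h1 h2 => hgood.2 r h1 (by omega)⟩
    rw [passPotential, if_pos hgood', one_mul]
    by_cases hflag : ∃ r, τ ≤ r ∧ r ≤ t ∧ ((run c A s₀ ω r).proc p).pc = i ∧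
        J < ((run c A s₀ ω r).proc p).batch
    · rw [if_pos hflag]
      refine lintegral_le_of_le fun u => ?_
      rw [passPotential]
      obtain ⟨r, h1, h2, h3⟩ := hflag
      rw [if_pos (⟨r, h1, by omega, by rwa [run_update h2]⟩ : ∃ r, _)]
      split_ifs <;> simp
    · rw [if_neg hflag]
      have hle : ∀ u, passPotential c A s₀ p J i f E m τ (t + 1) (Function.update ω t u) ≤
          passBound c J i f ((step c A (A.schedule t) u (run c A s₀ ω t)).proc p) := by
        intro u
        rw [passPotential, run_succ_update]
        split_ifs with h1 h2
        · obtain ⟨r, h3, h4, h5, h6⟩ := h2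
          rcases Nat.lt_or_ge t r with h7 | h7
          · have h8 : r = t + 1 := by omega
            rw [h8, run_succ_update] at h5 h6
            rw [passBound, if_neg (by omega), if_pos ⟨h5, h6⟩, one_mul]
          · rw [run_update h7] at h5 h6
            exact absurd ⟨r, h3, h7, h5, h6⟩ hflag
        · rw [one_mul]
        · rw [zero_mul]; exact zero_le
        · rw [zero_mul]; exact zero_le
      refine (lintegral_mono hle).trans ?_
      by_cases hp : A.schedule t = p
      · rw [hp]
        refine lintegral_passBound_step hc hJ hi (fun hpc => le_trans ?_ hf) fun hpc => ?_
        · gcongr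
          exact hgood.2 t hτ (by omega) hp hpc
        · by_contra hb
          exact hflag ⟨t, hτ, le_rfl, hpc, by omega⟩
      · simp only [step_proc_of_ne (Ne.symm hp)]
        exact lintegral_le_of_le fun _ => le_rfl
  · have : ∀ u, passPotential c A s₀ p J i f E m τ (t + 1) (Function.update ω t u) = 0 := by
      intro u
      rw [passPotential, if_neg, zero_mul]
      rintro ⟨h1, h2⟩
      refine hgood ⟨by rwa [hE.update hτ ω u] at h1, fun r h3 h4 h5 h6 => ?_⟩
      have := h2 r h3 h4 h5
      rw [run_update (by omega)] at this
      exact this h6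
    simp [this]

/-- A `get` that has not begun by time `τ`, and that finds at most `m` occupied slots in batch
`J` whenever it takes a step, is unlikely to lose all its trials in batch `J`. -/
theorem measure_pass_le (hc : ∀ b, 1 ≤ c b) (hJ : J < numBatches n)
    (hi : A.input p i = Op.get) {m : ℕ} (hf : (m : ℝ≥0∞) / (batchSize n J : ℝ≥0∞) ≤ f) (τ : ℕ) :
    coinMeasure n {ω | (((run c A s₀ ω τ).proc p).pc = i → ¬ ((run c A s₀ ω τ).proc p).Mid) ∧
        (∀ r, τ ≤ r → A.schedule r = p → ((run c A s₀ ω r).proc p).pc = i →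
          load J (run c A s₀ ω r) ≤ m) ∧
        ∃ r, τ ≤ r ∧ ((run c A s₀ ω r).proc p).pc = i ∧ J < ((run c A s₀ ω r).proc p).batch} ≤
      f ^ c J := by
  classical
  set E : Set (Coins n) :=
    {ω | ((run c A s₀ ω τ).proc p).pc = i → ¬ ((run c A s₀ ω τ).proc p).Mid} with hEdef
  have hE : Past τ (· ∈ E) := (past_run c A s₀ τ).comp
    fun s => ((s.proc p).pc = i → ¬ (s.proc p).Mid)
  -- The supermartingale bound needs a finite horizon; the bound is uniform in it, and the events
  -- increase to the required one.
  let Z : ℕ → Set (Coins n) := fun T => {ω | ω ∈ E ∧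
    (∀ r, τ ≤ r → A.schedule r = p → ((run c A s₀ ω r).proc p).pc = i →
      load J (run c A s₀ ω r) ≤ m) ∧
    ∃ r, τ ≤ r ∧ r ≤ T ∧ ((run c A s₀ ω r).proc p).pc = i ∧ J < ((run c A s₀ ω r).proc p).batch}
  have hZ : Monotone Z := by
    intro T T' hT ω hω
    obtain ⟨h1, h2, r, h3, h4, h5⟩ := hω
    exact ⟨h1, h2, r, h3, h4.trans hT, h5⟩
  have hsub : {ω | ω ∈ E ∧
        (∀ r, τ ≤ r → A.schedule r = p → ((run c A s₀ ω r).proc p).pc = i →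
          load J (run c A s₀ ω r) ≤ m) ∧
        ∃ r, τ ≤ r ∧ ((run c A s₀ ω r).proc p).pc = i ∧ J < ((run c A s₀ ω r).proc p).batch} ⊆
      ⋃ T, Z T := by
    rintro ω ⟨h1, h2, r, h3, h4⟩
    exact Set.mem_iUnion.2 ⟨r, h1, h2, r, h3, le_rfl, h4⟩
  refine (measure_mono hsub).trans ?_
  rw [hZ.measure_iUnion]
  refine iSup_le fun T => ?_
  refine (measure_mono (hZ (le_max_left T τ))).trans ?_
  set T' := max T τ with hT'
  have hτ : τ ≤ T' := le_max_right _ _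
  calc coinMeasure n (Z T') ≤
        coinMeasure n {ω | 1 ≤ passPotential c A s₀ p J i f E m τ T' ω} := by
        refine measure_mono fun ω hω => ?_
        obtain ⟨h1, h2, r, h3, h4, h5⟩ := hω
        change 1 ≤ passPotential c A s₀ p J i f E m τ T' ω
        rw [passPotential, if_pos ⟨h1, fun r h3 h4 => h2 r h3⟩, if_pos ⟨r, h3, h4, h5⟩, one_mul]
    _ ≤ ∫⁻ ω, passPotential c A s₀ p J i f E m τ T' ω ∂(coinMeasure n) := by
        have := mul_meas_ge_le_lintegral (μ := coinMeasure n)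
          ((past_passPotential (c := c) (A := A) (s₀ := s₀) (p := p) (J := J) (i := i) (f := f)
            (m := m) hE hτ).measurable) 1
        rwa [one_mul] at this
    _ ≤ ∫⁻ ω, passPotential c A s₀ p J i f E m τ τ ω ∂(coinMeasure n) :=
        lintegral_le_of_supermartingale hτ (fun t ht => past_passPotential hE ht)
          fun t h1 _ ω => passPotential_step hc hJ hi hf hE h1 ω
    _ ≤ ∫⁻ _, f ^ c J ∂(coinMeasure n) := by
        refine lintegral_mono fun ω => ?_
        by_cases hω : ω ∈ E
        · have h0 : ¬ ∃ r, τ ≤ r ∧ r ≤ τ ∧ ((run c A s₀ ω r).proc p).pc = i ∧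
              J < ((run c A s₀ ω r).proc p).batch := by
            rintro ⟨r, h1, h2, h3, h4⟩
            have h5 : r = τ := by omega
            subst h5
            have := hω h3
            simp only [ProcState.Mid, not_or, not_not] at this
            omega
          rw [passPotential, if_neg h0]
          refine (mul_le_of_le_one_left' ?_).trans (passBound_le_of_not_mid hc hω)
          split_ifs <;> simp
        · rw [passPotential, if_neg fun h => hω h.1, zero_mul]
          exact zero_le
    _ = f ^ c J := by simp

end SingleGet

/-! ### Counting the steps of an operation -/

section Counting

variable {n : ℕ} {c : ℕ → ℕ} {A : Adversary n} {s₀ : Config n} {ω : Coins n} {p : Fin n} {i : ℕ}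

theorem opSteps_succ (T : ℕ) :
    opSteps c A s₀ ω p i (T + 1) = opSteps c A s₀ ω p i T +
      if A.schedule T = p ∧ ((run c A s₀ ω T).proc p).pc = i then 1 else 0 := by
  classical
  unfold opSteps
  rw [Finset.range_add_one, Finset.filter_insert]
  split_ifs
  · rw [Finset.card_insert_of_notMem (by simp)]
  · rfl

/-- The minimum caps a trial number that is too large in the initial state: the next loss then
leaves the batch at once. -/
theorem opSteps_le_of_get (hc : ∀ b, 1 ≤ c b) (hi : A.input p i = Op.get) {J : ℕ}
    (hJ : J < numBatches n) (T : ℕ) :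
    (((run c A s₀ ω T).proc p).pc < i → opSteps c A s₀ ω p i T = 0) ∧
    (((run c A s₀ ω T).proc p).pc = i → ((run c A s₀ ω T).proc p).batch ≤ J →
      opSteps c A s₀ ω p i T ≤ ∑ b ∈ Finset.range ((run c A s₀ ω T).proc p).batch, c b +
        min ((run c A s₀ ω T).proc p).trial (c ((run c A s₀ ω T).proc p).batch - 1)) := by
  induction T with
  | zero => simp [opSteps]
  | succ T ih =>
    rw [opSteps_succ, run]
    have hpc := pc_step (c := c) (A := A) (p := A.schedule T) (u := ω T) (s := run c A s₀ ω T) p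
    by_cases hp : A.schedule T = p
    · rw [hp] at hpc ⊢
      rcases lt_trichotomy ((run c A s₀ ω T).proc p).pc i with hlt | heq | hgt
      · have := ih.1 hlt
        rw [if_neg (by omega), this]
        simp
      · rw [if_pos ⟨rfl, heq⟩]
        refine ⟨fun h => by omega, fun h hb => ?_⟩
        have hig : A.input p ((run c A s₀ ω T).proc p).pc = Op.get := by rw [heq, hi]
        rcases step_cases c A p (ω T) (run c A s₀ ω T) with ⟨-, -, -, h2⟩ | ⟨-, -, -, h2⟩ |
          ⟨hi', -⟩ | ⟨hi', -⟩ | ⟨hi', -⟩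
        · rw [h2] at hb ⊢
          have hb' := batch_le_afterLoss (n := n) (c := c) ((run c A s₀ ω T).proc p)
          have hT := ih.2 heq (hb'.trans hb)
          have := hc ((run c A s₀ ω T).proc p).batch
          rcases afterLoss_of_lt (n := n) (c := c) (l := (run c A s₀ ω T).proc p) (by omega) with
            ⟨h3, h4, h5⟩ | ⟨h3, h4, h5⟩
          · rw [h3, h4]; omega
          · rw [h3, h4, Finset.sum_range_succ]; omega
        · rw [h2] at h
          simp only [nextOp] at h
          omega
        · simp [hig] at hi'
        · simp [hig] at hi'
        · simp [hig] at hi'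
      · exact ⟨fun h => by omega, fun h => by omega⟩
    · rw [if_neg fun h => hp h.1, step_proc_of_ne (Ne.symm hp)]
      simpa using ih

/-- A `get` that stays in the batches up to `J` completes after few steps. -/
theorem completesWithin_of_batch_le {B : ℝ} (hB : CompactSchedule c A s₀ B)
    (hc : ∀ b, 1 ≤ c b) (hi : A.input p i = Op.get) {J t : ℕ} (hJ : J < numBatches n)
    (ht : Initiates c A s₀ ω p i t)
    (hb : ∀ r, t ≤ r → ((run c A s₀ ω r).proc p).pc = i → ((run c A s₀ ω r).proc p).batch ≤ J)
    {x : ℝ} (hx : ((∑ b ∈ Finset.range (J + 1), c b : ℕ) : ℝ) ≤ x) :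
    CompletesWithin c A s₀ ω p i x := by
  classical
  -- The `free` promised by compactness sits at a different position of the input, so the `get` must
  -- have completed by then.
  have hex : ∃ T, i < ((run c A s₀ ω T).proc p).pc := by
    obtain ⟨t', h1, -, h2⟩ := hB.1 ω p i t hi ht
    refine ⟨t', lt_of_le_of_ne ?_ ?_⟩
    · have := pc_mono (c := c) (A := A) (s₀ := s₀) (ω := ω) p h1.le
      rwa [ht.2.1] at this
    · intro h
      have := h2.2
      rw [← h, hi] at this
      exact Op.noConfusion this
  refine ⟨Nat.find hex, Nat.find_spec hex, le_trans ?_ hx⟩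
  have hpos : t < Nat.find hex := by
    by_contra h
    have h1 := pc_mono (c := c) (A := A) (s₀ := s₀) (ω := ω) p (not_lt.1 h)
    have h2 := Nat.find_spec hex
    have h3 := ht.2.1
    omega
  obtain ⟨T, hT⟩ : ∃ T, Nat.find hex = T + 1 := ⟨Nat.find hex - 1, by omega⟩
  have h1 : ¬ i < ((run c A s₀ ω T).proc p).pc := Nat.find_min hex (by omega)
  have h2 : ((run c A s₀ ω T).proc p).pc = i := by
    have := pc_mono (c := c) (A := A) (s₀ := s₀) (ω := ω) p (by omega : t ≤ T)
    rw [ht.2.1] at this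
    omega
  have hbT := hb T (by omega) h2
  have h3 := (opSteps_le_of_get (c := c) (s₀ := s₀) (ω := ω) hc hi hJ T).2 h2 hbT
  rw [hT, opSteps_succ]
  have h4 : ∑ b ∈ Finset.range (((run c A s₀ ω T).proc p).batch + 1), c b ≤
      ∑ b ∈ Finset.range (J + 1), c b :=
    Finset.sum_le_sum_of_subset (Finset.range_mono (by omega))
  rw [Finset.sum_range_succ] at h4
  have := hc ((run c A s₀ ω T).proc p).batch
  have h5 : opSteps c A s₀ ω p i T + (if A.schedule T = p ∧
      ((run c A s₀ ω T).proc p).pc = i then 1 else 0) ≤ ∑ b ∈ Finset.range (J + 1), c b := by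
    split_ifs <;> omega
  exact_mod_cast h5

/-- The alternative of zero steps is needed because a `collect` in progress at time 0 may carry a
trial number beyond the array size; it then ends at its first step. -/
theorem opSteps_le_of_not_get (hi : A.input p i ≠ Op.get) (T : ℕ) :
    (((run c A s₀ ω T).proc p).pc < i → opSteps c A s₀ ω p i T = 0) ∧
    (((run c A s₀ ω T).proc p).pc = i →
      opSteps c A s₀ ω p i T = 0 ∨ (opSteps c A s₀ ω p i T ≤ ((run c A s₀ ω T).proc p).trial ∧
        ((run c A s₀ ω T).proc p).trial < mainSize n + n)) ∧
    (i < ((run c A s₀ ω T).proc p).pc → opSteps c A s₀ ω p i T ≤ mainSize n + n + 1) := by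
  induction T with
  | zero => simp [opSteps]
  | succ T ih =>
    rw [opSteps_succ, run]
    have hpc := pc_step (c := c) (A := A) (p := A.schedule T) (u := ω T) (s := run c A s₀ ω T) p
    by_cases hp : A.schedule T = p
    · rw [hp] at hpc ⊢
      rcases lt_trichotomy ((run c A s₀ ω T).proc p).pc i with hlt | heq | hgt
      · have := ih.1 hlt
        rw [if_neg (by omega), this]
        simp
      · rw [if_pos ⟨rfl, heq⟩]
        have h1 := ih.2.1 heq
        refine ⟨fun h => by omega, fun h => Or.inr ?_, fun h => by omega⟩
        rcases step_cases c A p (ω T) (run c A s₀ ω T) with ⟨hi', -⟩ | ⟨hi', -⟩ |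
          ⟨-, -, h2⟩ | ⟨-, h3, -, h2⟩ | ⟨-, -, h2⟩
        · exact absurd (heq ▸ hi') hi
        · exact absurd (heq ▸ hi') hi
        · rw [h2] at h; simp only [nextOp] at h; omega
        · rw [h2]; dsimp only; omega
        · rw [h2] at h; simp only [nextOp] at h; omega
      · have := ih.2.2 hgt
        rw [if_neg (by omega)]
        exact ⟨fun h => by omega, fun h => by omega, fun _ => this⟩
    · rw [if_neg fun h => hp h.1, step_proc_of_ne (Ne.symm hp)]
      simpa using ih

/-- In a compact execution, every operation takes a bounded number of steps. -/
theorem opSteps_le {B : ℝ} (hA : IsInitial A s₀) (hB : CompactSchedule c A s₀ B) (T : ℕ) :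
    opSteps c A s₀ ω p i T ≤ ⌈(n : ℝ) ^ B⌉₊ + mainSize n + n + 1 := by
  classical
  by_cases hi : A.input p i = Op.get
  · by_cases hex : ∃ t, A.schedule t = p ∧ ((run c A s₀ ω t).proc p).pc = i
    · obtain ⟨h1, h2⟩ := Nat.find_spec hex
      set t := Nat.find hex with ht
      obtain ⟨t', h3, h4, h5⟩ : ∃ t', t ≤ t' ∧ t' ≤ t + ⌈(n : ℝ) ^ B⌉₊ ∧
          ExecutesFree c A s₀ ω p t' := by
        by_cases hm : ((run c A s₀ ω t).proc p).Mid
        · obtain ⟨t', h3, h4, h5⟩ := hB.exists_free hA p t (Or.inr ⟨by rw [h2, hi], hm⟩)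
          exact ⟨t', h3, h4.le, h5⟩
        · simp only [ProcState.Mid, not_or, not_not] at hm
          obtain ⟨t', h3, h4, h5⟩ := hB.1 ω p i t hi ⟨h1, h2, hm.1, hm.2⟩
          refine ⟨t', h3.le, ?_, h5⟩
          have : (t' : ℝ) ≤ ((t + ⌈(n : ℝ) ^ B⌉₊ : ℕ) : ℝ) := by
            push_cast
            linarith [Nat.le_ceil ((n : ℝ) ^ B)]
          exact_mod_cast this
      have h6 : i < ((run c A s₀ ω t').proc p).pc := by
        refine lt_of_le_of_ne ?_ ?_
        · have := pc_mono (c := c) (A := A) (s₀ := s₀) (ω := ω) p h3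
          rwa [h2] at this
        · intro h
          have := h5.2
          rw [← h, hi] at this
          exact Op.noConfusion this
      have h7 : opSteps c A s₀ ω p i T ≤ (Finset.Ico t t').card := by
        refine Finset.card_le_card fun r hr => ?_
        rw [Finset.mem_filter] at hr
        rw [Finset.mem_Ico]
        refine ⟨Nat.find_min' hex hr.2, ?_⟩
        by_contra h
        have := pc_mono (c := c) (A := A) (s₀ := s₀) (ω := ω) p (not_lt.1 h)
        omega
      rw [Nat.card_Ico] at h7
      omega
    · have : opSteps c A s₀ ω p i T = 0 := by
        rw [opSteps, Finset.card_eq_zero]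
        exact Finset.filter_eq_empty_iff.2 fun r _ h => hex ⟨r, h⟩
      omega
  · have h := opSteps_le_of_not_get (c := c) (s₀ := s₀) (ω := ω) hi T
    rcases lt_trichotomy ((run c A s₀ ω T).proc p).pc i with hlt | heq | hgt
    · have := h.1 hlt
      omega
    · have := h.2.1 heq
      omega
    · have := h.2.2 hgt
      omega

open Classical in
/-- There are few times at which `p` takes a step and at which, judging from its counter `D` time
units before, it may be in the operation at position `i`. -/
theorem card_candidate_le {K : ℕ}
    (hK : ∀ j T, opSteps c A s₀ ω p j T ≤ K) (D M : ℕ) :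
    ((Finset.range M).filter fun s => A.schedule s = p ∧
      ((run c A s₀ ω (s - D)).proc p).pc ≤ i ∧
        i ≤ ((run c A s₀ ω (s - D)).proc p).pc + D).card ≤ D + (D + 1) * (K + D) := by
  let F : ℕ → Finset ℕ := fun j => (Finset.range M).filter fun s => D ≤ s ∧ A.schedule s = p ∧
    ((run c A s₀ ω (s - D)).proc p).pc = j
  have hF : ∀ j, (F j).card ≤ K + D := by
    intro j
    by_cases hex : ∃ b, j < ((run c A s₀ ω b).proc p).pc
    · have hsub : F j ⊆ ((Finset.range M).filter fun s => A.schedule s = p ∧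
          ((run c A s₀ ω s).proc p).pc = j) ∪ Finset.Ico (Nat.find hex) (Nat.find hex + D) := by
        intro s hs
        rw [Finset.mem_filter] at hs
        obtain ⟨h1, h2, h3, h4⟩ := hs
        have h5 := pc_mono (c := c) (A := A) (s₀ := s₀) (ω := ω) p (Nat.sub_le s D)
        rw [h4] at h5
        rw [Finset.mem_union, Finset.mem_filter, Finset.mem_Ico]
        rcases h5.lt_or_eq with h6 | h6
        · right
          refine ⟨Nat.find_min' hex h6, ?_⟩
          by_contra h7
          have h8 := pc_mono (c := c) (A := A) (s₀ := s₀) (ω := ω) p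
            (by omega : Nat.find hex ≤ s - D)
          have h9 := Nat.find_spec hex
          omega
        · exact Or.inl ⟨h1, h3, h6.symm⟩
      refine (Finset.card_le_card hsub).trans ((Finset.card_union_le _ _).trans ?_)
      rw [Nat.card_Ico, Nat.add_sub_cancel_left]
      exact Nat.add_le_add_right (hK j M) D
    · have hsub : F j ⊆ (Finset.range M).filter fun s => A.schedule s = p ∧
          ((run c A s₀ ω s).proc p).pc = j := by
        intro s hs
        rw [Finset.mem_filter] at hs
        obtain ⟨h1, h2, h3, h4⟩ := hs
        have h5 := pc_mono (c := c) (A := A) (s₀ := s₀) (ω := ω) p (Nat.sub_le s D)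
        have h6 : ¬ j < ((run c A s₀ ω s).proc p).pc := fun h => hex ⟨s, h⟩
        exact Finset.mem_filter.2 ⟨h1, h3, by omega⟩
      exact ((Finset.card_le_card hsub).trans (hK j M)).trans (Nat.le_add_right K D)
  -- The first `D` times are counted separately, because `s - D` is truncated to 0 there.
  have hsub : ((Finset.range M).filter fun s => A.schedule s = p ∧
      ((run c A s₀ ω (s - D)).proc p).pc ≤ i ∧ i ≤ ((run c A s₀ ω (s - D)).proc p).pc + D) ⊆
      Finset.range D ∪ (Finset.Icc (i - D) i).biUnion F := by
    intro s hs
    rw [Finset.mem_filter] at hs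
    obtain ⟨h1, h2, h3, h4⟩ := hs
    rw [Finset.mem_union, Finset.mem_range]
    rcases Nat.lt_or_ge s D with h5 | h5
    · exact Or.inl h5
    · refine Or.inr (Finset.mem_biUnion.2 ⟨_, Finset.mem_Icc.2 ⟨?_, h3⟩,
        Finset.mem_filter.2 ⟨h1, h5, h2, rfl⟩⟩)
      omega
  refine (Finset.card_le_card hsub).trans ((Finset.card_union_le _ _).trans ?_)
  rw [Finset.card_range]
  refine Nat.add_le_add_left ((Finset.card_biUnion_le_card_mul _ _ _ fun j _ => hF j).trans ?_) D
  refine Nat.mul_le_mul_right _ ?_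
  rw [Nat.card_Icc]
  omega

end Counting

/-! ### Balanced executions -/

section Balance

variable {n : ℕ} {c : ℕ → ℕ} {A : Adversary n} {s₀ : Config n} {B : ℝ} {J D : ℕ} {m : ℕ → ℕ}
  {f : ℕ → ℝ≥0∞} {ε : ℝ≥0∞}

/-- The numerical conditions on thresholds `m` for the loads of the batches up to `J`, and on
bounds `f` for the probability to lose a trial, under which a batch whose predecessor respects
its threshold exceeds its own with probability at most `ε`. -/
structure Thresholds (n : ℕ) (c : ℕ → ℕ) (J : ℕ) (m : ℕ → ℕ) (f : ℕ → ℝ≥0∞) (ε : ℝ≥0∞) :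
    Prop where
  lt_numBatches : J < numBatches n
  one_le_trials : ∀ b, 1 ≤ c b
  le_zero : n ≤ m 0
  div_le : ∀ a ≤ J, (m a : ℝ≥0∞) / (batchSize n a : ℝ≥0∞) ≤ f a
  mul_le_one : ∀ a < J, f a ^ c a * (trialsUpTo c a : ℕ) ≤ 1
  pow_le : ∀ a < J, (1 + f a ^ c a * (trialsUpTo c a : ℕ)) ^ n ≤ ε * 2 ^ (m (a + 1) + 1)

/-- The load of batch `J` respects its threshold with high probability, conditionally on an event
determined by a sufficiently remote past. -/
theorem measure_overload_le (hA : IsInitial A s₀) (hB : CompactSchedule c A s₀ B)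
    (h : Thresholds n c J m f ε) (hD : D = J * ⌈(n : ℝ) ^ B⌉₊) {s : ℕ}
    (hs : s₀ = emptyConfig n ∨ D ≤ s) {E : Set (Coins n)} (hE : Past (s - D) (· ∈ E)) :
    coinMeasure n {ω | ω ∈ E ∧ m J < load J (run c A s₀ ω s)} ≤
      coinMeasure n E * ((J * (D + 1) : ℕ) * ε) := by
  classical
  set N := ⌈(n : ℝ) ^ B⌉₊ with hN
  let X : ℕ → ℕ → Set (Coins n) := fun a T =>
    {ω | ω ∈ E ∧ (∀ r, T - N ≤ r → r < T → load a (run c A s₀ ω r) ≤ m a) ∧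
      m (a + 1) + 1 ≤ load (a + 1) (run c A s₀ ω T)}
  let I : ℕ → Finset ℕ := fun a => Finset.Icc (s - (J - (a + 1)) * N) s
  have hmulJ : ∀ a < J, (J - (a + 1)) * N + N = (J - a) * N := by
    intro a ha
    rw [← Nat.succ_mul]
    congr 1
    omega
  have hmul_le : ∀ k ≤ J, k * N ≤ D := fun k hk => hD ▸ Nat.mul_le_mul_right N hk
  have hX : ∀ a < J, ∀ T ∈ I a, coinMeasure n (X a T) ≤ coinMeasure n E * ε := by
    intro a ha T hT
    rw [Finset.mem_Icc] at hT
    have h1 := hmulJ a ha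
    have h2 := hmul_le (J - a) (by omega)
    have hτE : Past (T - N) (· ∈ E) := hE.mono (by omega)
    -- If the window is cut off at time 0, the run starts empty and nobody is busy; with `D ≤ s` no
    -- window is cut off.
    have hfree : ∀ ω q, Busy A q ((run c A s₀ ω (T - N)).proc q) →
        ∃ t, T - N ≤ t ∧ t < T ∧ ExecutesFree c A s₀ ω q t := by
      intro ω q hb
      by_cases hTN : N ≤ T
      · obtain ⟨t, h3, h4, h5⟩ := hB.exists_free hA q (T - N) hb
        exact ⟨t, h3, by omega, h5⟩
      · rcases hs with hs | hs
        · have : T - N = 0 := by omega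
          rw [this, run, hs] at hb
          exact absurd hb (not_busy_emptyConfig A q)
        · have h3 : N ≤ (a + 1) * N := Nat.le_mul_of_pos_left N (by omega)
          have h4 : (J - (a + 1)) * N + (a + 1) * N = D := by
            rw [hD, ← add_mul]
            congr 1
            omega
          omega
    have key := measure_load_mul_pow_le (E := E) (T := T) hA h.one_le_trials
      (by have := h.lt_numBatches; omega) (h.mul_le_one a ha) (h.div_le a ha.le) hτE
      (Nat.sub_le T N) hfree (m (a + 1) + 1)
    have h0 : (2 : ℝ≥0∞) ^ (m (a + 1) + 1) ≠ 0 := by positivity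
    have htop : (2 : ℝ≥0∞) ^ (m (a + 1) + 1) ≠ ∞ := ENNReal.pow_ne_top (by norm_num)
    refine (ENNReal.mul_le_mul_iff_left h0 htop).1 (key.trans ?_)
    rw [mul_assoc]
    gcongr
    exact h.pow_le a ha
  have hsub : {ω | ω ∈ E ∧ m J < load J (run c A s₀ ω s)} ⊆
      ⋃ a ∈ Finset.range J, ⋃ T ∈ I a, X a T := by
    rintro ω ⟨hω, hload⟩
    by_contra hno
    simp only [Set.mem_iUnion, not_exists, Finset.mem_range] at hno
    -- The interval of control shrinks by `N` per level: goodness of batch `a + 1` at `T` uses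
    -- goodness of batch `a` throughout the `N` time units before.
    have claim : ∀ l ≤ J, ∀ T, s - (J - l) * N ≤ T → T ≤ s →
        load l (run c A s₀ ω T) ≤ m l := by
      intro l
      induction l with
      | zero =>
        intro _ T _ _
        exact ((hA.consistent_run ω T).load_le_card 0).trans h.le_zero
      | succ a ih =>
        intro ha T h1 h2
        by_contra h3
        have h4 := hmulJ a (by omega)
        refine hno a (by omega) T (Finset.mem_Icc.2 ⟨h1, h2⟩) ⟨hω, fun r h5 h6 => ?_, by omega⟩
        exact ih (by omega) r (by omega) (by omega)
    have := claim J le_rfl s (by simp) le_rfl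
    omega
  calc coinMeasure n {ω | ω ∈ E ∧ m J < load J (run c A s₀ ω s)}
      ≤ coinMeasure n (⋃ a ∈ Finset.range J, ⋃ T ∈ I a, X a T) := measure_mono hsub
    _ ≤ ∑ a ∈ Finset.range J, ∑ T ∈ I a, coinMeasure n (X a T) :=
        (measure_biUnion_finset_le _ _).trans
          (Finset.sum_le_sum fun a _ => measure_biUnion_finset_le _ _)
    _ ≤ ∑ a ∈ Finset.range J, ((D + 1 : ℕ) : ℝ≥0∞) * (coinMeasure n E * ε) := by
        refine Finset.sum_le_sum fun a ha => ?_
        rw [Finset.mem_range] at ha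
        refine (Finset.sum_le_sum fun T hT => hX a ha T hT).trans ?_
        rw [Finset.sum_const, nsmul_eq_mul]
        gcongr
        rw [Nat.card_Icc]
        have := hmul_le (J - (a + 1)) (by omega)
        omega
    _ = coinMeasure n E * ((J * (D + 1) : ℕ) * ε) := by
        rw [Finset.sum_const, Finset.card_range, nsmul_eq_mul]
        push_cast
        ring

open Classical in
/-- The batch `J` is unlikely to be overcrowded when a fixed operation takes a step. -/
theorem measure_exists_overload_le (hA : IsInitial A s₀) (hB : CompactSchedule c A s₀ B)
    (h : Thresholds n c J m f ε) (hD : D = J * ⌈(n : ℝ) ^ B⌉₊) {τ : ℕ}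
    (hτ : s₀ = emptyConfig n ∨ D ≤ τ) (p : Fin n) (i : ℕ) :
    coinMeasure n {ω | ∃ s, τ ≤ s ∧ A.schedule s = p ∧ ((run c A s₀ ω s).proc p).pc = i ∧
        m J < load J (run c A s₀ ω s)} ≤
      ((D + (D + 1) * (⌈(n : ℝ) ^ B⌉₊ + mainSize n + n + 1 + D) : ℕ) : ℝ≥0∞) *
        ((J * (D + 1) : ℕ) * ε) := by
  -- `E s` is what time `s - D` reveals about whether `p` is at position `i` at time `s`: a counter
  -- gains at most 1 per time unit.
  let E : ℕ → Set (Coins n) := fun s => {ω | A.schedule s = p ∧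
    ((run c A s₀ ω (s - D)).proc p).pc ≤ i ∧ i ≤ ((run c A s₀ ω (s - D)).proc p).pc + D}
  have hE : ∀ s, Past (s - D) (· ∈ E s) := fun s => (past_run c A s₀ (s - D)).comp
    fun x => (A.schedule s = p ∧ (x.proc p).pc ≤ i ∧ i ≤ (x.proc p).pc + D)
  have hEm : ∀ s, MeasurableSet (E s) := fun s => measurableSet_setOfPred.2 (hE s).measurable
  let Y : ℕ → Set (Coins n) := fun s =>
    {ω | τ ≤ s ∧ ω ∈ E s ∧ m J < load J (run c A s₀ ω s)}
  have hY : ∀ s, coinMeasure n (Y s) ≤ coinMeasure n (E s) * ((J * (D + 1) : ℕ) * ε) := by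
    intro s
    by_cases hs : τ ≤ s
    · refine (measure_mono fun ω hω => ?_).trans
        (measure_overload_le hA hB h hD (hτ.imp_right fun h => h.trans hs) (hE s))
      exact hω.2
    · have : Y s = ∅ := Set.eq_empty_of_forall_notMem fun ω hω => hs hω.1
      rw [this, measure_empty]
      exact zero_le
  have hsub : {ω | ∃ s, τ ≤ s ∧ A.schedule s = p ∧ ((run c A s₀ ω s).proc p).pc = i ∧
        m J < load J (run c A s₀ ω s)} ⊆ ⋃ s, Y s := by
    rintro ω ⟨s, h1, h2, h3, h4⟩
    refine Set.mem_iUnion.2 ⟨s, h1, ⟨h2, ?_, ?_⟩, h4⟩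
    · rw [← h3]
      exact pc_mono p (Nat.sub_le s D)
    · have := pc_le_add (c := c) (A := A) (s₀ := s₀) (ω := ω) p (s - D) (s - (s - D))
      rw [Nat.add_sub_cancel' (Nat.sub_le s D), h3] at this
      omega
  calc _ ≤ coinMeasure n (⋃ s, Y s) := measure_mono hsub
    _ ≤ ∑' s, coinMeasure n (Y s) := measure_iUnion_le _
    _ ≤ ∑' s, coinMeasure n (E s) * ((J * (D + 1) : ℕ) * ε) := ENNReal.tsum_le_tsum hY
    _ = (∑' s, coinMeasure n (E s)) * ((J * (D + 1) : ℕ) * ε) := ENNReal.tsum_mul_right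
    _ ≤ _ := by
        gcongr
        -- The sum of the probabilities is the expected number of candidate times, which is bounded
        -- for every outcome.
        refine ENNReal.tsum_le_of_sum_range_le fun M => ?_
        calc ∑ s ∈ Finset.range M, coinMeasure n (E s)
            = ∫⁻ ω, ∑ s ∈ Finset.range M, (E s).indicator 1 ω ∂(coinMeasure n) := by
              rw [lintegral_finsetSum _ fun s _ => measurable_one.indicator (hEm s)]
              exact Finset.sum_congr rfl fun s _ => (lintegral_indicator_one (hEm s)).symm
          _ ≤ ∫⁻ _, ((D + (D + 1) * (⌈(n : ℝ) ^ B⌉₊ + mainSize n + n + 1 + D) : ℕ) : ℝ≥0∞)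
                ∂(coinMeasure n) := by
              refine lintegral_mono fun ω => ?_
              have h1 : ∑ s ∈ Finset.range M, (E s).indicator (1 : Coins n → ℝ≥0∞) ω =
                  (((Finset.range M).filter fun s => A.schedule s = p ∧
                    ((run c A s₀ ω (s - D)).proc p).pc ≤ i ∧
                    i ≤ ((run c A s₀ ω (s - D)).proc p).pc + D).card : ℝ≥0∞) := by
                rw [Finset.card_filter]
                push_cast
                refine Finset.sum_congr rfl fun s _ => ?_
                rw [Set.indicator_apply]
                exact if_congr Iff.rfl rfl rfl
              rw [h1]
              exact Nat.cast_le.2 (card_candidate_le (fun j T => opSteps_le hA hB T) D M)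
          _ = _ := by simp

/-- The probability that a fixed `get`, if initiated at time `τ` or later, does not complete within
the batches up to `J`. -/
theorem measure_not_completesWithin_le (hA : IsInitial A s₀) (hB : CompactSchedule c A s₀ B)
    (h : Thresholds n c J m f ε) (hD : D = J * ⌈(n : ℝ) ^ B⌉₊) {τ : ℕ}
    (hτ : s₀ = emptyConfig n ∨ D ≤ τ) {p : Fin n} {i : ℕ} (hi : A.input p i = Op.get) {x : ℝ}
    (hx : ((∑ b ∈ Finset.range (J + 1), c b : ℕ) : ℝ) ≤ x) :
    coinMeasure n {ω | ∃ t, τ ≤ t ∧ Initiates c A s₀ ω p i t ∧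
        ¬ CompletesWithin c A s₀ ω p i x} ≤
      f J ^ c J + ((D + (D + 1) * (⌈(n : ℝ) ^ B⌉₊ + mainSize n + n + 1 + D) : ℕ) : ℝ≥0∞) *
        ((J * (D + 1) : ℕ) * ε) := by
  refine le_trans (measure_mono ?_) ((measure_union_le _ _).trans (add_le_add
    (measure_pass_le (s₀ := s₀) h.one_le_trials h.lt_numBatches hi (h.div_le J le_rfl) τ)
    (measure_exists_overload_le hA hB h hD hτ p i)))
  rintro ω ⟨t, ht, hinit, hno⟩
  by_cases hload : ∃ s, τ ≤ s ∧ A.schedule s = p ∧ ((run c A s₀ ω s).proc p).pc = i ∧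
        m J < load J (run c A s₀ ω s)
  · exact Or.inr hload
  · refine Or.inl ⟨fun hpc hm => ?_, fun r h1 h2 h3 => ?_, ?_⟩
    · have := mid_run (c := c) (A := A) (s₀ := s₀) (ω := ω) p ht hm (by rw [hpc, hinit.2.1])
      rcases this with h1 | h1
      · exact h1 hinit.2.2.1
      · exact h1 hinit.2.2.2
    · by_contra h4
      exact hload ⟨r, h1, h2, h3, by omega⟩
    · by_contra hnone
      refine hno (completesWithin_of_batch_le hB h.one_le_trials hi h.lt_numBatches hinit
        (fun r h1 h2 => ?_) hx)
      by_contra h3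
      exact hnone ⟨r, ht.trans h1, h2, by omega⟩

end Balance

/-! ### Choice of the thresholds -/

/-- The bound for the probability to lose a trial in batch `a`. -/
noncomputable def lossBound (a : ℕ) : ℝ := if a = 0 then 3 / 4 else (1 / 2) ^ (4 ^ a - (a + 1))

/-- The threshold for the load of batch `a`. -/
def threshold (n a : ℕ) : ℕ := if a = 0 then n else n / 2 ^ 4 ^ a

/-- The last batch to which the analysis applies. -/
def lastLevel (n : ℕ) : ℕ := Nat.log 4 (Nat.log 2 n / 2)

theorem two_mul_succ_le_four_pow {a : ℕ} (ha : 1 ≤ a) : 2 * (a + 1) ≤ 4 ^ a := by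
  induction a, ha using Nat.le_induction with
  | base => norm_num
  | succ a ha ih => rw [pow_succ]; omega

theorem lossBound_nonneg (a : ℕ) : 0 ≤ lossBound a := by
  unfold lossBound; split_ifs <;> positivity

theorem lossBound_le_one (a : ℕ) : lossBound a ≤ 1 := by
  unfold lossBound
  split_ifs
  · norm_num
  · exact pow_le_one₀ (by norm_num) (by norm_num)

theorem lossBound_le {a x : ℕ} (ha : 1 ≤ a) (hx : 4 ^ a = 2 * x) : lossBound a ≤ (1 / 2) ^ x := by
  have := two_mul_succ_le_four_pow ha
  rw [lossBound, if_neg (by omega)]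
  exact pow_le_pow_of_le_one (by norm_num) (by norm_num) (by omega)

/-- The contraction from level `a` to `a + 1`. With 4^a = 2(y+1), the required exponent is 8y + 10.
The factor ρκ2^(-κ) gives 11 and the remaining losses give 9y, while `a + 2` costs at most y + 1;
hence the constants 9 and 11. -/
theorem lossBound_pow_mul_le {ρ : ℝ} (hρ : 0 ≤ ρ) {κ : ℕ} (hκ : 9 ≤ κ)
    (h : ρ * κ * (3 / 4) ^ κ ≤ (1 / 2) ^ 11) (a : ℕ) :
    lossBound a ^ κ * ((a + 2) * (ρ * κ)) ≤ (1 / 2) ^ (4 ^ (a + 1) + 2) := by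
  have hρκ : 0 ≤ ρ * κ := by positivity
  rcases Nat.eq_zero_or_pos a with rfl | ha
  · simp only [lossBound, if_true, Nat.cast_zero]
    norm_num at h ⊢
    linarith
  · obtain ⟨x, hx⟩ : ∃ x, 4 ^ a = 2 * x := by
      obtain ⟨b, rfl⟩ : ∃ b, a = b + 1 := ⟨a - 1, by omega⟩
      exact ⟨2 * 4 ^ b, by rw [pow_succ]; ring⟩
    have hax := two_mul_succ_le_four_pow ha
    obtain ⟨y, rfl⟩ : ∃ y, x = y + 1 := ⟨x - 1, by omega⟩
    have h1 : lossBound a ^ κ ≤ (1 / 2) ^ κ * (1 / 2) ^ (9 * y) := by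
      calc lossBound a ^ κ ≤ ((1 / 2) ^ (y + 1)) ^ κ :=
            pow_le_pow_left₀ (lossBound_nonneg a) (lossBound_le ha hx) κ
        _ = (1 / 2) ^ (κ + κ * y) := by rw [← pow_mul]; ring_nf
        _ ≤ (1 / 2) ^ (κ + 9 * y) := by
            refine pow_le_pow_of_le_one (by norm_num) (by norm_num) ?_
            gcongr
        _ = _ := pow_add _ _ _
    have h2 : (a + 2 : ℝ) ≤ 2 ^ (y + 1) := by
      have : a + 2 ≤ 2 ^ (y + 1) := by
        have h3 : y + 1 < 2 ^ (y + 1) := Nat.lt_two_pow_self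
        omega
      exact_mod_cast this
    have h3 : ρ * κ * (1 / 2) ^ κ ≤ (1 / 2) ^ 11 :=
      le_trans (mul_le_mul_of_nonneg_left
        (pow_le_pow_left₀ (by norm_num) (by norm_num) κ) hρκ) h
    calc lossBound a ^ κ * ((a + 2) * (ρ * κ))
        ≤ ((1 / 2) ^ κ * (1 / 2) ^ (9 * y)) * (2 ^ (y + 1) * (ρ * κ)) := by gcongr
      _ = (ρ * κ * (1 / 2) ^ κ) * ((1 / 2) ^ (9 * y) * 2 ^ (y + 1)) := by ring
      _ ≤ (1 / 2) ^ 11 * ((1 / 2) ^ (9 * y) * 2 ^ (y + 1)) := by gcongr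
      _ = (1 / 2) ^ (10 + 8 * y) * ((1 / 2) ^ (y + 1) * 2 ^ (y + 1)) := by ring
      _ = (1 / 2) ^ (4 ^ (a + 1) + 2) := by
          rw [← mul_pow, pow_succ 4 a, hx]
          norm_num
          ring

theorem four_pow_lastLevel_le {n : ℕ} (hn : 4 ≤ n) : 4 ^ lastLevel n ≤ Nat.log 2 n / 2 := by
  refine Nat.pow_log_le_self 4 ?_
  have : 2 ≤ Nat.log 2 n := Nat.le_log_of_pow_le (by norm_num) (by omega)
  omega

theorem one_le_lastLevel {n : ℕ} (hn : 2 ^ 8 ≤ n) : 1 ≤ lastLevel n := by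
  refine Nat.le_log_of_pow_le (by norm_num) ?_
  have : 8 ≤ Nat.log 2 n := Nat.le_log_of_pow_le (by norm_num) hn
  omega

theorem lastLevel_lt {n : ℕ} (hn : 4 ≤ n) : lastLevel n < Nat.log 2 n := by
  have h1 := four_pow_lastLevel_le hn
  have h2 : lastLevel n < 4 ^ lastLevel n := Nat.lt_pow_self (by norm_num)
  omega

theorem threshold_div_le {n : ℕ} (hn : 3 ≤ n) {a : ℕ} (ha : a < numBatches n) :
    (threshold n a : ℝ≥0∞) / (batchSize n a : ℝ≥0∞) ≤ ENNReal.ofReal (lossBound a) := by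
  have hpos := batchSize_pos n a ha
  have key : (threshold n a : ℝ) / (batchSize n a : ℝ) ≤ lossBound a := by
    have hpos' : (0 : ℝ) < batchSize n a := by exact_mod_cast hpos
    rw [div_le_iff₀ hpos']
    rcases Nat.eq_zero_or_pos a with rfl | h
    · simp only [threshold, batchSize, lossBound, if_true]
      -- The value 3/4 instead of 2/3 absorbs the rounding in the size of batch 0.
      have : 4 * n ≤ 3 * (3 * n / 2) := by omega
      have h2 : (4 * n : ℝ) ≤ 3 * ((3 * n / 2 : ℕ) : ℝ) := by exact_mod_cast this
      linarith
    · have h1 := two_mul_succ_le_four_pow h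
      simp only [threshold, batchSize, lossBound, if_neg (by omega : ¬ a = 0)]
      have h2 : n / 2 ^ 4 ^ a * 2 ^ (4 ^ a - (a + 1)) ≤ n / 2 ^ (a + 1) := by
        rw [Nat.le_div_iff_mul_le (by positivity), mul_assoc, ← pow_add,
          Nat.sub_add_cancel (by omega)]
        exact Nat.div_mul_le_self _ _
      have h3 : ((n / 2 ^ 4 ^ a : ℕ) : ℝ) * 2 ^ (4 ^ a - (a + 1)) ≤ ((n / 2 ^ (a + 1) : ℕ) : ℝ) := by
        exact_mod_cast h2
      rw [one_div, inv_pow, inv_mul_eq_div, le_div_iff₀ (by positivity)]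
      exact h3
  rw [← ENNReal.ofReal_natCast, ← ENNReal.ofReal_natCast, ← ENNReal.ofReal_div_of_pos
    (by exact_mod_cast hpos)]
  exact ENNReal.ofReal_le_ofReal key

/-- `lastLevel` stops while 2^(4^a) is at most √n, so that every threshold is still large enough for
an exponential tail. -/
theorem sqrt_le_threshold {n : ℕ} (hn : 4 ≤ n) {a : ℕ} (ha : a < lastLevel n) :
    √(n : ℝ) ≤ (threshold n (a + 1) : ℝ) + 1 := by
  have h1 := four_pow_lastLevel_le hn
  have h2 : 4 ^ (a + 1) ≤ 4 ^ lastLevel n := Nat.pow_le_pow_right (by norm_num) ha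
  have h3 : (2 ^ 4 ^ (a + 1)) ^ 2 ≤ n := by
    rw [← pow_mul]
    refine le_trans (Nat.pow_le_pow_right (by norm_num) ?_)
      (Nat.pow_log_le_self 2 (by omega : n ≠ 0))
    omega
  have h4 : ((2 : ℝ) ^ 4 ^ (a + 1)) ≤ √(n : ℝ) := by
    refine Real.le_sqrt_of_sq_le ?_
    exact_mod_cast h3
  have h5 : (n : ℝ) / 2 ^ 4 ^ (a + 1) ≤ (threshold n (a + 1) : ℝ) + 1 := by
    rw [threshold, if_neg (by omega), div_le_iff₀ (by positivity)]
    have := Nat.lt_mul_div_succ n (by positivity : 0 < 2 ^ 4 ^ (a + 1))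
    have h6 : n ≤ (n / 2 ^ 4 ^ (a + 1) + 1) * 2 ^ 4 ^ (a + 1) := by linarith
    exact_mod_cast h6
  refine le_trans ?_ h5
  rw [le_div_iff₀ (by positivity)]
  calc √(n : ℝ) * 2 ^ 4 ^ (a + 1) ≤ √(n : ℝ) * √(n : ℝ) := by gcongr
    _ = n := Real.mul_self_sqrt (by positivity)

theorem sum_trials_le {ρ : ℝ} {κ : ℕ} {c : ℕ → ℕ}
    (hc : ∀ b, κ ≤ c b ∧ (c b : ℝ) ≤ ρ * κ) (k : ℕ) :
    ((∑ b ∈ Finset.range k, c b : ℕ) : ℝ) ≤ k * (ρ * κ) := by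
  push_cast
  refine (Finset.sum_le_sum fun b _ => (hc b).2).trans ?_
  simp

theorem thresholds_lastLevel {ρ : ℝ} (hρ : 0 ≤ ρ) {κ : ℕ} (hκ : 9 ≤ κ)
    (h : ρ * κ * (3 / 4) ^ κ ≤ (1 / 2) ^ 11) {n : ℕ} (hn : 4 ≤ n) {c : ℕ → ℕ}
    (hc : ∀ b, κ ≤ c b ∧ (c b : ℝ) ≤ ρ * κ) :
    Thresholds n c (lastLevel n) (threshold n) (fun a => ENNReal.ofReal (lossBound a))
      (ENNReal.ofReal (Real.exp (-(1 / 4) * √n))) := by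
  have hlt : lastLevel n < numBatches n := lastLevel_lt hn
  have hprod : ∀ a, lossBound a ^ c a * (trialsUpTo c a : ℕ) ≤ (1 / 2) ^ (4 ^ (a + 1) + 2) := by
    intro a
    refine le_trans ?_ (lossBound_pow_mul_le hρ hκ h a)
    have h1 : lossBound a ^ c a ≤ lossBound a ^ κ :=
      pow_le_pow_of_le_one (lossBound_nonneg a) (lossBound_le_one a) (hc a).1
    have h2 : ((trialsUpTo c a : ℕ) : ℝ) ≤ (a + 2) * (ρ * κ) := by
      have := sum_trials_le hc (a + 2)
      push_cast at this
      rw [trialsUpTo]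
      push_cast
      exact this
    have := lossBound_nonneg a
    gcongr
  have hcast : ∀ a, ENNReal.ofReal (lossBound a) ^ c a * (trialsUpTo c a : ℕ) =
      ENNReal.ofReal (lossBound a ^ c a * (trialsUpTo c a : ℕ)) := by
    intro a
    rw [ENNReal.ofReal_mul (pow_nonneg (lossBound_nonneg a) _),
      ENNReal.ofReal_pow (lossBound_nonneg a), ENNReal.ofReal_natCast]
  have hnonneg : ∀ a, 0 ≤ lossBound a ^ c a * (trialsUpTo c a : ℕ) := fun a =>
    mul_nonneg (pow_nonneg (lossBound_nonneg a) _) (Nat.cast_nonneg _)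
  refine ⟨hlt, fun b => by have := (hc b).1; omega, by simp [threshold],
    fun a ha => threshold_div_le (by omega) (by omega), fun a _ => ?_, fun a ha => ?_⟩
  · rw [hcast, ENNReal.ofReal_le_one]
    exact (hprod a).trans (pow_le_one₀ (by norm_num) (by norm_num))
  · rw [hcast]
    set y := lossBound a ^ c a * (trialsUpTo c a : ℕ) with hy
    set M := threshold n (a + 1) with hM
    rw [← ENNReal.ofReal_one, ← ENNReal.ofReal_add zero_le_one (hnonneg a),
      ← ENNReal.ofReal_pow (by linarith [hnonneg a]), ← ENNReal.ofReal_ofNat,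
      ← ENNReal.ofReal_pow (by norm_num), ← ENNReal.ofReal_mul (Real.exp_pos _).le]
    refine ENNReal.ofReal_le_ofReal ?_
    -- The bound `n * y` on the mean load is at most a quarter of `M + 1`. As 2 ≥ exp (1/2), the
    -- exponential moment leaves (M+1)/4 - (M+1)/2 = -(M+1)/4 in the exponent. The `+ 1` absorbs the
    -- floor in the threshold.
    have h1 : (n : ℝ) * y ≤ ((M : ℝ) + 1) / 4 := by
      have h2 : (n : ℝ) ≤ (M + 1) * 2 ^ 4 ^ (a + 1) := by
        rw [hM, threshold, if_neg (by omega)]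
        have := Nat.lt_mul_div_succ n (by positivity : 0 < 2 ^ 4 ^ (a + 1))
        have h6 : n ≤ (n / 2 ^ 4 ^ (a + 1) + 1) * 2 ^ 4 ^ (a + 1) := by linarith
        exact_mod_cast h6
      calc (n : ℝ) * y ≤ ((M + 1) * 2 ^ 4 ^ (a + 1)) * (1 / 2) ^ (4 ^ (a + 1) + 2) := by
            gcongr
            · exact hnonneg a
            · exact hprod a
        _ = (M + 1) / 4 * (2 ^ 4 ^ (a + 1) * (1 / 2) ^ 4 ^ (a + 1)) := by ring
        _ = (M + 1) / 4 := by rw [← mul_pow]; norm_num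
    have h2 := sqrt_le_threshold hn ha
    rw [← hM] at h2
    have hexp : Real.exp (1 / 2) ≤ 2 := by
      have h3 : Real.exp (1 / 2) ^ 2 ≤ 2 ^ 2 := by
        rw [← Real.exp_nat_mul]
        have := Real.exp_one_lt_d9
        norm_num
        linarith
      exact (pow_le_pow_iff_left₀ (Real.exp_pos _).le (by norm_num) two_ne_zero).1 h3
    calc (1 + y) ^ n ≤ Real.exp y ^ n := by
          refine pow_le_pow_left₀ (by linarith [hnonneg a]) ?_ n
          linarith [Real.add_one_le_exp y]
      _ = Real.exp (n * y) := (Real.exp_nat_mul y n).symm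
      _ ≤ Real.exp (-(1 / 4) * √n + ((M + 1 : ℕ) : ℝ) * (1 / 2)) := by
          refine Real.exp_le_exp.2 ?_
          push_cast
          linarith
      _ = Real.exp (-(1 / 4) * √n) * Real.exp (1 / 2) ^ (M + 1) := by
          rw [Real.exp_add, Real.exp_nat_mul]
      _ ≤ Real.exp (-(1 / 4) * √n) * 2 ^ (M + 1) := by gcongr

/-! ### Asymptotics -/

/-- By maximality of `lastLevel`, 4^J exceeds an eighth of log n up to rounding, and each trial in
batch J is lost with probability at most 2^(-4^J/2); so 16(γ+1) trials suffice. -/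
theorem lossBound_lastLevel_pow_le {γ : ℝ} (hγ : 0 ≤ γ) {κ k n : ℕ} (hκ : 16 * (γ + 1) ≤ κ)
    (hk : κ ≤ k) (hn : 2 ^ 8 ≤ n) :
    lossBound (lastLevel n) ^ k ≤ 1 / (n : ℝ) ^ (γ + 1) := by
  have hJ := one_le_lastLevel hn
  obtain ⟨b, hb⟩ : ∃ b, lastLevel n = b + 1 := ⟨lastLevel n - 1, by omega⟩
  set x := 2 * 4 ^ b with hx
  have h4 : 4 ^ lastLevel n = 2 * x := by rw [hb, pow_succ, hx]; ring
  have hn0 : (0 : ℝ) < n := by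
    have : 0 < n := by omega
    exact_mod_cast this
  have h1 : n ≤ 2 ^ (16 * x) := by
    have h2 : Nat.log 2 n / 2 < 4 ^ (lastLevel n + 1) := Nat.lt_pow_succ_log_self (by norm_num) _
    refine (Nat.lt_pow_succ_log_self (by norm_num : 1 < 2) n).le.trans
      (Nat.pow_le_pow_right (by norm_num) ?_)
    rw [pow_succ, h4] at h2
    simp only [Nat.succ_eq_add_one]
    omega
  have h2 : (n : ℝ) ≤ 2 ^ (16 * x) := by exact_mod_cast h1
  have h3 : (n : ℝ) ^ (γ + 1) ≤ 2 ^ (x * κ) := by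
    calc (n : ℝ) ^ (γ + 1) ≤ ((2 : ℝ) ^ (16 * x)) ^ (γ + 1) :=
          Real.rpow_le_rpow hn0.le h2 (by linarith)
      _ = (2 : ℝ) ^ ((x : ℝ) * (16 * (γ + 1))) := by
          rw [← Real.rpow_natCast, ← Real.rpow_mul (by norm_num)]
          push_cast
          ring_nf
      _ ≤ (2 : ℝ) ^ ((x : ℝ) * κ) := by
          refine Real.rpow_le_rpow_of_exponent_le (by norm_num) ?_
          gcongr
      _ = 2 ^ (x * κ) := by
          rw [← Real.rpow_natCast]
          push_cast
          rfl
  calc lossBound (lastLevel n) ^ k ≤ lossBound (lastLevel n) ^ κ :=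
        pow_le_pow_of_le_one (lossBound_nonneg _) (lossBound_le_one _) hk
    _ ≤ ((1 / 2) ^ x) ^ κ := pow_le_pow_left₀ (lossBound_nonneg _) (lossBound_le hJ h4) κ
    _ = 1 / 2 ^ (x * κ) := by rw [← pow_mul, one_div_pow]
    _ ≤ 1 / (n : ℝ) ^ (γ + 1) := by
        have : 0 < (n : ℝ) ^ (γ + 1) := Real.rpow_pos_of_pos hn0 _
        gcongr

theorem two_mul_lastLevel_le_loglog {n : ℕ} (hn : 4 ≤ n) : (2 * lastLevel n : ℝ) ≤ loglog n := by
  have h1 := four_pow_lastLevel_le hn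
  have hn0 : (0 : ℝ) < n := by
    have : 0 < n := by omega
    exact_mod_cast this
  have h2 : ((4 : ℝ) ^ lastLevel n) ≤ Real.logb 2 n := by
    have h3 : ((4 ^ lastLevel n : ℕ) : ℝ) ≤ (Nat.log 2 n : ℝ) := by
      exact_mod_cast h1.trans (Nat.div_le_self _ _)
    push_cast at h3
    refine h3.trans ?_
    exact_mod_cast Real.natLog_le_logb n 2
  rw [loglog, Real.le_logb_iff_rpow_le (by norm_num) (lt_of_lt_of_le (by positivity) h2)]
  refine le_trans (le_of_eq ?_) h2
  rw [Real.rpow_mul (by norm_num), Real.rpow_natCast]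
  norm_num

/-- The number of exceptional events is polynomial in `n`. -/
theorem exceptional_count_le {n b N J : ℕ} (hn : 10 ≤ n) (hN : N ≤ n ^ b) (hJ : J ≤ n) :
    (J * N + (J * N + 1) * (N + mainSize n + n + 1 + J * N)) * (J * (J * N + 1)) ≤
      n ^ (3 * b + 9) := by
  have hm : mainSize n ≤ 2 * n := batchStart_le n _
  have hb : 1 ≤ n ^ b := Nat.one_le_pow _ _ (by omega)
  have hD : J * N ≤ n ^ (b + 1) := by
    rw [pow_succ, mul_comm (n ^ b)]
    exact Nat.mul_le_mul hJ hN
  have h1 : n ≤ n ^ (b + 1) := by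
    rw [pow_succ]; nlinarith
  have hbb : n ^ b ≤ n ^ (b + 1) := Nat.pow_le_pow_right (by omega) (by omega)
  set y := n ^ (b + 1) with hy
  have h2 : n * y = n ^ (b + 2) := by rw [hy]; ring
  have h3 : J * N + 1 ≤ n ^ (b + 2) := by nlinarith
  have h4 : N + mainSize n + n + 1 + J * N ≤ n ^ (b + 2) := by nlinarith
  have h5 : J * N + (J * N + 1) * (N + mainSize n + n + 1 + J * N) ≤ n ^ (2 * b + 6) := by
    have h6 : (J * N + 1) * (N + mainSize n + n + 1 + J * N) ≤ n ^ (b + 2) * n ^ (b + 2) :=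
      Nat.mul_le_mul h3 h4
    have h7 : n ^ (b + 2) ≤ n ^ (b + 2) * n ^ (b + 2) :=
      Nat.le_mul_of_pos_right _ (by positivity)
    have h8 : n ^ (2 * b + 6) = n * n * (n ^ (b + 2) * n ^ (b + 2)) := by ring
    have h9 : 2 ≤ n * n := by nlinarith
    have h10 : 2 * (n ^ (b + 2) * n ^ (b + 2)) ≤ n * n * (n ^ (b + 2) * n ^ (b + 2)) :=
      Nat.mul_le_mul_right _ h9
    omega
  calc _ ≤ n ^ (2 * b + 6) * (n * n ^ (b + 2)) :=
        Nat.mul_le_mul h5 (Nat.mul_le_mul hJ h3)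
    _ = n ^ (3 * b + 9) := by ring

open Filter Topology in
theorem eventually_pow_mul_exp_le (γ : ℝ) (d : ℕ) :
    ∀ᶠ n : ℕ in atTop, (n : ℝ) ^ d * Real.exp (-(1 / 4) * √n) ≤ 1 / 2 * (1 / (n : ℝ) ^ γ) := by
  -- Used at √n, whence the doubled exponent.
  have h1 := tendsto_rpow_mul_exp_neg_mul_atTop_nhds_zero (2 * (d + γ)) (1 / 4) (by norm_num)
  have h2 : Tendsto (fun n : ℕ => √(n : ℝ)) atTop atTop :=
    Real.tendsto_sqrt_atTop.comp tendsto_natCast_atTop_atTop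
  have h3 := (h1.comp h2).eventually (Iic_mem_nhds (by norm_num : (0 : ℝ) < 1 / 2))
  filter_upwards [h3, eventually_ge_atTop 1] with n hn hpos
  have hn0 : (0 : ℝ) < n := by exact_mod_cast hpos
  have h4 : √(n : ℝ) ^ (2 * ((d : ℝ) + γ)) = (n : ℝ) ^ d * (n : ℝ) ^ γ := by
    rw [Real.rpow_mul (Real.sqrt_nonneg _), Real.rpow_two, Real.sq_sqrt hn0.le,
      Real.rpow_add hn0, Real.rpow_natCast]
  simp only [Function.comp_apply, h4] at hn
  have h5 : 0 < (n : ℝ) ^ γ := Real.rpow_pos_of_pos hn0 _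
  rw [← mul_div_assoc, mul_one, le_div_iff₀ h5]
  linarith

open Filter Topology in
theorem eventually_mul_pow_le (ρ : ℝ) :
    ∀ᶠ κ : ℕ in atTop, ρ * κ * (3 / 4) ^ κ ≤ (1 / 2) ^ 11 := by
  have h := (tendsto_self_mul_const_pow_of_lt_one (by norm_num : (0 : ℝ) ≤ 3 / 4)
    (by norm_num)).const_mul ρ
  rw [mul_zero] at h
  filter_upwards [h.eventually (Iic_mem_nhds (by norm_num : (0 : ℝ) < (1 / 2) ^ 11))] with κ hκ
  simpa only [Set.mem_Iic, mul_assoc] using hκ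

theorem one_sub_le_real_of_compl {n : ℕ} {G : Set (Coins n)} {x : ℝ} (hx : 0 ≤ x)
    (h : coinMeasure n Gᶜ ≤ ENNReal.ofReal x) : 1 - x ≤ (coinMeasure n).real G := by
  have h1 : (coinMeasure n).real Gᶜ ≤ x := ENNReal.toReal_le_of_le_ofReal hx h
  have h2 := measureReal_union_le (μ := coinMeasure n) G Gᶜ
  rw [Set.union_compl_self, probReal_univ] at h2
  linarith

end LevelArray

/-! ### The main theorem. -/

open LevelArray MeasureTheory in
theorem mainTheorem2 (γ : ℝ) (hγ : 1 ≤ γ) (ρ : ℝ) (hρ : 1 ≤ ρ) :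
    ∃ κ₀ : ℕ, ∀ κ : ℕ, κ₀ ≤ κ → ∃ C : ℝ, ∀ B : ℝ, 0 ≤ B → ∃ n₀ : ℕ, ∀ n : ℕ, n₀ ≤ n →
      ∀ c : ℕ → ℕ, (∀ b : ℕ, κ ≤ c b ∧ (c b : ℝ) ≤ ρ * (κ : ℝ)) →
      ∀ (A : LevelArray.Adversary n) (s₀ : LevelArray.Config n),
        LevelArray.IsInitial A s₀ → LevelArray.CompactSchedule c A s₀ B →
        ∀ (p : Fin n) (i : ℕ), A.input p i = LevelArray.Op.get →
          (s₀ = LevelArray.emptyConfig n →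
            1 - 1 / (n : ℝ) ^ γ ≤ (LevelArray.coinMeasure n).real
              {ω | ∀ t : ℕ, LevelArray.Initiates c A s₀ ω p i t →
                LevelArray.CompletesWithin c A s₀ ω p i (C * LevelArray.loglog n)}) ∧
          1 - 1 / (n : ℝ) ^ γ ≤ (LevelArray.coinMeasure n).real
            {ω | ∀ t : ℕ, (n : ℝ) ^ B * LevelArray.loglog n ≤ (t : ℝ) →
              LevelArray.Initiates c A s₀ ω p i t →
              LevelArray.CompletesWithin c A s₀ ω p i (C * LevelArray.loglog n)} := by
  obtain ⟨κ₁, hκ₁⟩ := Filter.eventually_atTop.1 (eventually_mul_pow_le ρ)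
  -- `κ₁` and 9 are for the contraction between levels, 16(γ+1) for the trials in the last batch.
  -- The exponent `B` enters only the polynomial count of exceptional events, hence only `n₀`.
  refine ⟨max κ₁ (max 9 ⌈16 * (γ + 1)⌉₊), fun κ hκ => ⟨ρ * κ, fun B hB => ?_⟩⟩
  have hκ9 : 9 ≤ κ := le_trans (le_trans (le_max_left _ _) (le_max_right _ _)) hκ
  have hκγ : 16 * (γ + 1) ≤ κ := (Nat.le_ceil _).trans
    (by exact_mod_cast le_trans (le_trans (le_max_right _ _) (le_max_right _ _)) hκ)
  have hκρ := hκ₁ κ (le_trans (le_max_left _ _) hκ)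
  set d := ⌈B⌉₊ with hd
  obtain ⟨n₁, hn₁⟩ := Filter.eventually_atTop.1 (eventually_pow_mul_exp_le γ (3 * d + 9))
  refine ⟨max n₁ (2 ^ 8), fun n hn c hc A s₀ hA hcomp p i hi => ?_⟩
  have hn8 : 2 ^ 8 ≤ n := (le_max_right _ _).trans hn
  have hexp := hn₁ n ((le_max_left _ _).trans hn)
  have hn1 : (1 : ℝ) ≤ n := by
    have : 1 ≤ n := by omega
    exact_mod_cast this
  have hn0 : (0 : ℝ) < n := by linarith
  have hth := thresholds_lastLevel (by linarith) hκ9 hκρ (by omega : 4 ≤ n) hc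
  set J := lastLevel n with hJ
  set N := ⌈(n : ℝ) ^ B⌉₊ with hN
  have hJ1 : 1 ≤ J := one_le_lastLevel hn8
  have hJlog : (2 * J : ℝ) ≤ loglog n := two_mul_lastLevel_le_loglog (by omega)
  have hJn : J ≤ n := (lastLevel_lt (by omega)).le.trans (Nat.log_le_self 2 n)
  have hN' : N ≤ n ^ d := by
    refine Nat.ceil_le.2 ?_
    push_cast
    rw [← Real.rpow_natCast]
    exact Real.rpow_le_rpow_of_exponent_le hn1 (Nat.le_ceil B)
  have hγ0 : 0 < (n : ℝ) ^ γ := Real.rpow_pos_of_pos hn0 _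
  have hx : ((∑ b ∈ Finset.range (J + 1), c b : ℕ) : ℝ) ≤ ρ * κ * loglog n := by
    refine (sum_trials_le hc (J + 1)).trans ?_
    rw [mul_comm]
    have h1 : (1 : ℝ) ≤ J := by exact_mod_cast hJ1
    gcongr
    push_cast
    linarith
  -- Both parts follow, with τ = 0 for the empty start and τ = J·N otherwise.
  have hbad : ∀ τ : ℕ, (s₀ = emptyConfig n ∨ J * N ≤ τ) →
      coinMeasure n {ω | ∃ t, τ ≤ t ∧ Initiates c A s₀ ω p i t ∧
        ¬ CompletesWithin c A s₀ ω p i (ρ * κ * loglog n)} ≤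
        ENNReal.ofReal (1 / (n : ℝ) ^ γ) := by
    intro τ hτ
    refine (measure_not_completesWithin_le hA hcomp hth rfl hτ hi hx).trans ?_
    rw [← mul_assoc, ← Nat.cast_mul, ← ENNReal.ofReal_pow (lossBound_nonneg _),
      ← ENNReal.ofReal_natCast, ← ENNReal.ofReal_mul (Nat.cast_nonneg _),
      ← ENNReal.ofReal_add (pow_nonneg (lossBound_nonneg _) _) (by positivity)]
    refine ENNReal.ofReal_le_ofReal ?_
    have h1 := lossBound_lastLevel_pow_le (by linarith) hκγ (hc J).1 hn8
    -- The surplus power of n makes this term at most half of the allowed failure probability;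
    -- overloads get the other half.
    have h2 : 1 / (n : ℝ) ^ (γ + 1) ≤ 1 / 2 * (1 / (n : ℝ) ^ γ) := by
      rw [Real.rpow_add hn0, Real.rpow_one, ← one_div_mul_one_div, mul_comm]
      gcongr
      have : 2 ≤ n := by omega
      exact_mod_cast this
    have h3 := exceptional_count_le (by omega : 10 ≤ n) hN' hJn
    have h4 := mul_le_mul_of_nonneg_right
      (by exact_mod_cast h3 : (((J * N + (J * N + 1) * (N + mainSize n + n + 1 + J * N)) *
        (J * (J * N + 1)) : ℕ) : ℝ) ≤ (n : ℝ) ^ (3 * d + 9))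
      (Real.exp_pos (-(1 / 4) * √n)).le
    linarith
  refine ⟨fun hs => ?_, ?_⟩
  · refine one_sub_le_real_of_compl (by positivity) (le_trans (measure_mono ?_)
      (hbad 0 (Or.inl hs)))
    intro ω hω
    simp only [Set.mem_compl_iff, Set.mem_ofPred_eq, not_forall] at hω
    obtain ⟨t, h1, h2⟩ := hω
    exact ⟨t, Nat.zero_le t, h1, h2⟩
  · refine one_sub_le_real_of_compl (by positivity) (le_trans (measure_mono ?_)
      (hbad (J * N) (Or.inr le_rfl)))
    intro ω hω
    simp only [Set.mem_compl_iff, Set.mem_ofPred_eq, not_forall] at hω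
    obtain ⟨t, h0, h1, h2⟩ := hω
    refine ⟨t, ?_, h1, h2⟩
    have h3 : (1 : ℝ) ≤ (n : ℝ) ^ B := Real.one_le_rpow hn1 hB
    -- The ceiling costs at most a factor 2, absorbed by 2J ≤ log log n.
    have h4 : (N : ℝ) ≤ 2 * (n : ℝ) ^ B := by
      have := Nat.ceil_lt_add_one (by positivity : 0 ≤ (n : ℝ) ^ B)
      rw [← hN] at this
      linarith
    have h5 : ((J * N : ℕ) : ℝ) ≤ t := by
      refine le_trans ?_ h0
      push_cast
      calc (J : ℝ) * N ≤ J * (2 * (n : ℝ) ^ B) := by gcongr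
        _ = (n : ℝ) ^ B * (2 * J) := by ring
        _ ≤ _ := by gcongr
    exact_mod_cast h5
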